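/- **Setting.** Let $R$ be an irreducible, reduced, finite (crystallographic) root system in a finite-dimensional $\mathbb Q$-vector space $V$, with coroots $\alpha^\vee\in V^*$, simple roots $\Pi$, highest root $\tilde\alpha$ and weight lattice $X$. Let $\widehat{\mathcal W}$ be the affine Weyl group, generated by the reflections $v\mapsto v-(\langle\alpha,v\rangle+n)\alpha^\vee$ of $V^*$, denoted $s_{(\alpha,n)}$, for the affine roots $(\alpha,n)$, $\alpha\in R$, $n\in\mathbb Z$. It acts on $\widehat X=X\oplus\mathbb Z$, whose elements $(\lambda,k)$ are regarded as the affine functions $v\mapsto\langle\lambda,v\rangle+k$ on $V^*$. The positive affine roots are $(\alpha,n)$ with $n>0$ and $(\alpha,0)$ with $\alpha>0$; the simple ones are $(\alpha,0)$, $\alpha\in\Pi$, and $(-\tilde\alpha,1)$; $\widehat{\mathcal S}$ is the set of the corresponding simple reflections, and $<$ is the Bruhat order. Let $F$ be a field of characteristic different from $2$, and let $S$ be the symmetric algebra of $\widehat X\otimes_{\mathbb Z}F$, graded with $\widehat X\otimes F$ in degree $2$; write $\bar\lambda=\lambda\otimes1$. Let $\widehat{\mathcal G}$ be the moment graph with set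 of vertices $\widehat{\mathcal W}$ and an edge $x\to y$ labelled $\bar\alpha$ whenever $\alpha$ is a positive affine root, $x<y$ and $y=s_\alpha x$. For $I\subset\widehat{\mathcal W}$ let $\widehat{\mathcal G}_I$ be the full subgraph on $I$; it has the GKM-property if the labels of any two distinct edges of $\widehat{\mathcal G}_I$ with a common vertex are not proportional. Let $\mathcal Z(I)=\{z\in\prod_{x\in I}S: z_x\equiv z_y\bmod\bar\alpha\text{ for every edge }x\xrightarrow{\bar\alpha}y\text{ of }\widehat{\mathcal G}_I\}$. A sheaf $\mathcal M$ on a moment graph consists of graded $S$-modules $\mathcal M^x$ for the vertices $x$ and $\mathcal M^E$ for the edges $E$, with $\mathcal M^E$ killed by the label $l(E)$, and graded homomorphisms $\rho_{x,E}:\mathcal M^x\to\mathcal M^E$ for $x$ lying on $E$. Sections over a set of vertices $I$ are $\Gamma(I,\mathcal M)=\{m\in\prod_{x\in I}\mathcal M^x:\rho_{x,E}(m_x)=\rho_{y,E}(m_y)\text{ for all edges }E\text{ joining }x,y\in I\}$, and $\Gamma(\mathcal M)$ is the module of global sections. The costalk at $x$ is $\mathcal M_x=\{m\in\mathcal M^x:\rho_{x,E}(m)=0\text{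 for all edges }E\text{ containing }x\}$. For $s\in\widehat{\mathcal S}$ write $\bar x=\{x,xs\}$ and let $\widehat{\mathcal G}^s$ be the quotient graph with vertices $\bar x$, whose edges $\bar E:\bar x\to\bar y$ (with $\bar x\neq\bar y$) are the images of the edges $E:x\to y$ of $\widehat{\mathcal G}$, with the same labels; each $\bar E$ comes from two edges $E$ and $Es:xs\to ys$. For a sheaf $\mathcal P$ on $\widehat{\mathcal G}$, $\mathcal N=\vartheta^s_{on}\mathcal P$ is the sheaf on $\widehat{\mathcal G}^s$ with $\mathcal N^{\bar x}=\Gamma(\{x,xs\},\mathcal P)$, with $\mathcal N^{\bar E}$ the image of $\mathcal N^{\bar y}$ under $\rho_{y,E}\oplus\rho_{ys,Es}$ for $\bar E:\bar x\to\bar y$, and with restrictions $\rho_{x,E}\oplus\rho_{xs,Es}$ and $\rho_{y,E}\oplus\rho_{ys,Es}$ (it is applied to sheaves for which the first of these maps $\mathcal N^{\bar x}$ into $\mathcal N^{\bar E}$). For a sheaf $\mathcal N$ on $\widehat{\mathcal G}^s$, $\mathcal M=\vartheta^s_{out}\mathcal N$ is the sheaf on $\widehat{\mathcal G}$ with $\mathcal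 M^x=\mathcal N^{\bar x}$, with $\mathcal M^E=\mathcal N^{\bar x}/l(E)\mathcal N^{\bar x}$ and the natural projections if $E$ joins $x$ and $xs$, and with $\mathcal M^E=\mathcal N^{\bar E}$ and the restrictions of $\mathcal N$ otherwise. Put $\vartheta^s=\vartheta^s_{out}\circ\vartheta^s_{on}$. Let $\mathcal B(e)$ be the sheaf on $\widehat{\mathcal G}$ with stalk $S$ at the unit $e$ and all other modules zero. For a sequence $\mathbf s=(s_1,\dots,s_l)$ in $\widehat{\mathcal S}$ put $\mathcal B(\mathbf s)=\vartheta^{s_l}\cdots\vartheta^{s_1}\mathcal B(e)$. Let $I(\mathbf s)$ be the set of the $2^l$ sequences $\sigma$ obtained from $\mathbf s$ by replacing some entries by blanks, $\mathrm{ev}(\sigma)$ the product of the remaining entries, $I(\mathbf s)_x=\{\sigma:\mathrm{ev}(\sigma)=x\}$ and $J(\mathbf s)=\mathrm{ev}(I(\mathbf s))$. The submodule $\mathcal X(\mathbf s)\subset\bigoplus_{\sigma\in I(\mathbf s)}S$ is defined by $\mathcal X(\emptyset)=S$ and $\mathcal X(\mathbf s)=\Delta(\mathcal X(\mathbf s'))+c^{\alpha_l}\Delta(\mathcal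 X(\mathbf s'))$, where $\mathbf s'=(s_1,\dots,s_{l-1})$, $\Delta(f)_\sigma=f_{\sigma'}$ with $\sigma'$ denoting $\sigma$ without its last entry, $\alpha_l$ is the simple affine root with $s_l=s_{\alpha_l}$, and $(c^\lambda f)_\sigma=\overline{\mathrm{ev}(\sigma)(\lambda)}f_\sigma$. Finally $\mathcal X(\mathbf s)^x=\{f|_{I(\mathbf s)_x}:f\in\mathcal X(\mathbf s)\}$ and $\mathcal X(\mathbf s)_x=\{f|_{I(\mathbf s)_x}:f\in\mathcal X(\mathbf s),\ f_\sigma=0\text{ for all }\sigma\notin I(\mathbf s)_x\}$. **Statement.** Let $\mathbf s$ be a sequence in $\widehat{\mathcal S}$ such that $\widehat{\mathcal G}_{J(\mathbf s)}$ has the GKM-property. Then there exist an $S$-module isomorphism $\phi:\Gamma(\mathcal B(\mathbf s))\to\mathcal X(\mathbf s)$ that is an isomorphism of $\mathcal Z(J(\mathbf s))$-modules (where $(zm)_x=z_xm_x$ and $(zf)_\sigma=z_{\mathrm{ev}(\sigma)}f_\sigma$) and $S$-module isomorphisms $\phi_x:\mathcal B(\mathbf s)^x\to\mathcal X(\mathbf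 s)^x$ for all $x\in\widehat{\mathcal W}$ such that $\phi_x(m_x)=\phi(m)|_{I(\mathbf s)_x}$ for all $m\in\Gamma(\mathcal B(\mathbf s))$ and all $x$. For any such $\phi$ and $(\phi_x)_x$ and every $x\in\widehat{\mathcal W}$, the isomorphism $\phi_x$ restricts to an isomorphism of $S$-modules $\mathcal B(\mathbf s)_x\to\mathcal X(\mathbf s)_x$ of costalks. -/

import Mathlib

open scoped TensorProduct

universe u

noncomputable section

namespace BottSamelson

/-! ### Graded modules over a symmetric algebra -/

section Graded

variable (F : Type u) [Field F] (W : Type u) [AddCommGroup W] [Module F W]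

/-- The homogeneous component of degree `n` of the symmetric algebra `S = S(W)`, graded so that
the elements of `W` have degree `2`: it is `W ^ k` (span of the `k`-fold products of elements
of `W`) if `n = 2 k` with `k ≥ 0`, and `0` otherwise. -/
def symDeg (n : ℤ) : Submodule F (SymmetricAlgebra F W) :=
  if 0 ≤ n ∧ Even n then (LinearMap.range (SymmetricAlgebra.ι F W)) ^ (n / 2).toNat else ⊥

/-- A `ℤ`-graded module over `S = S(W)`. -/
structure GrMod where
  carrier : Type u
  [addCommGroup : AddCommGroup carrier]
  [module : Module (SymmetricAlgebra F W) carrier]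
  /-- the homogeneous components -/
  deg : ℤ → AddSubgroup carrier
  isInternal : DirectSum.IsInternal deg
  smul_mem : ∀ (i j : ℤ) (a : SymmetricAlgebra F W) (m : carrier),
    a ∈ symDeg F W i → m ∈ deg j → a • m ∈ deg (i + j)

attribute [instance] GrMod.addCommGroup GrMod.module

instance : CoeSort (GrMod F W) (Type u) := ⟨GrMod.carrier⟩

/-- Criterion for a grading in terms of the projections to the components. -/
theorem isInternal_of_proj {A : Type*} [AddCommGroup A] (d : ℤ → AddSubgroup A)
    (p : ℤ → A →+ A) (h₁ : ∀ i m, p i m ∈ d i) (h₂ : ∀ i, ∀ m ∈ d i, p i m = m)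
    (h₃ : ∀ i j, i ≠ j → ∀ m ∈ d i, p j m = 0)
    (h₄ : ∀ m, ∃ t : Finset ℤ, (∀ i ∉ t, p i m = 0) ∧ ∑ i ∈ t, p i m = m) :
    DirectSum.IsInternal d := by
  classical
  have key : ∀ (j : ℤ) (f : DirectSum ℤ fun i => d i),
      p j (DirectSum.coeAddMonoidHom d f) = f j := by
    intro j f
    induction f using DirectSum.induction_on with
    | zero => simp
    | of i x =>
      rw [DirectSum.coeAddMonoidHom_of]
      by_cases h : i = j
      · subst h
        rw [DirectSum.of_eq_same]
        exact h₂ _ _ x.2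
      · rw [DirectSum.of_eq_of_ne _ _ _ (Ne.symm h)]
        exact h₃ _ _ h _ x.2
    | add x y hx hy => rw [map_add, map_add, hx, hy, DirectSum.add_apply]; rfl
  constructor
  · rw [injective_iff_map_eq_zero]
    intro f hf
    ext j
    rw [← key, hf]
    simp
  · intro m
    obtain ⟨t, -, ht⟩ := h₄ m
    refine ⟨∑ i ∈ t, DirectSum.of (fun i => d i) i ⟨p i m, h₁ i m⟩, ?_⟩
    rw [map_sum]
    conv_rhs => rw [← ht]
    exact Finset.sum_congr rfl fun i _ => DirectSum.coeAddMonoidHom_of _ _ _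

variable {F W}

namespace GrMod

/-- The projection of a graded module to its component of degree `i`. -/
def proj (M : GrMod F W) (i : ℤ) : M →+ M :=
  ((M.deg i).subtype.comp (DFinsupp.evalAddMonoidHom i)).comp
    (AddEquiv.ofBijective (DirectSum.coeAddMonoidHom M.deg) M.isInternal).symm.toAddMonoidHom

theorem proj_coe (M : GrMod F W) (i : ℤ) (f : DirectSum ℤ fun i => M.deg i) :
    M.proj i (DirectSum.coeAddMonoidHom M.deg f) = f i := by
  have : (AddEquiv.ofBijective (DirectSum.coeAddMonoidHom M.deg) M.isInternal).symm
      (DirectSum.coeAddMonoidHom M.deg f) = f :=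
    (AddEquiv.ofBijective (DirectSum.coeAddMonoidHom M.deg) M.isInternal).symm_apply_apply f
  change (((AddEquiv.ofBijective (DirectSum.coeAddMonoidHom M.deg) M.isInternal).symm
      (DirectSum.coeAddMonoidHom M.deg f)) i : M) = f i
  rw [this]

theorem proj_mem (M : GrMod F W) (i : ℤ) (m : M) : M.proj i m ∈ M.deg i :=
  SetLike.coe_mem _

theorem proj_same (M : GrMod F W) (i : ℤ) (m : M) (hm : m ∈ M.deg i) : M.proj i m = m := by
  have := M.proj_coe i (DirectSum.of (fun i => M.deg i) i ⟨m, hm⟩)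
  rwa [DirectSum.coeAddMonoidHom_of, DirectSum.of_eq_same] at this

theorem proj_ne (M : GrMod F W) (i j : ℤ) (h : i ≠ j) (m : M) (hm : m ∈ M.deg i) :
    M.proj j m = 0 := by
  have := M.proj_coe j (DirectSum.of (fun i => M.deg i) i ⟨m, hm⟩)
  rwa [DirectSum.coeAddMonoidHom_of, DirectSum.of_eq_of_ne _ _ _ (Ne.symm h)] at this

theorem proj_sum (M : GrMod F W) (m : M) :
    ∃ t : Finset ℤ, (∀ i ∉ t, M.proj i m = 0) ∧ ∑ i ∈ t, M.proj i m = m := by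
  classical
  obtain ⟨f, rfl⟩ := M.isInternal.2 m
  refine ⟨DFinsupp.support f, fun i hi => ?_, ?_⟩
  · rw [proj_coe, DFinsupp.notMem_support_iff.1 hi]; rfl
  · simp only [proj_coe]
    exact (DirectSum.coeAddMonoidHom_eq_dfinsuppSum _ f).symm

/-- Homomorphisms of degree `0` commute with the projections. -/
theorem map_proj {M N : GrMod F W} (f : M →ₗ[SymmetricAlgebra F W] N)
    (hf : ∀ i, ∀ m ∈ M.deg i, f m ∈ N.deg i) (i : ℤ) (m : M) :
    f (M.proj i m) = N.proj i (f m) := by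
  classical
  obtain ⟨t, ht, hm⟩ := M.proj_sum m
  conv_rhs => rw [← hm, map_sum, map_sum]
  have h : ∀ j ∈ t, N.proj i (f (M.proj j m)) = if j = i then f (M.proj i m) else 0 := by
    intro j _
    split_ifs with h
    · subst h
      exact N.proj_same _ _ (hf _ _ (M.proj_mem _ _))
    · exact N.proj_ne _ _ h _ (hf _ _ (M.proj_mem _ _))
  rw [Finset.sum_congr rfl h, Finset.sum_ite_eq']
  split_ifs with hi
  · rfl
  · rw [ht i hi, map_zero]

/-- Multiplication by an element of degree `k` shifts the projections by `k`. -/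
theorem proj_smul (M : GrMod F W) (a : SymmetricAlgebra F W) (k : ℤ) (ha : a ∈ symDeg F W k)
    (i : ℤ) (m : M) : M.proj i (a • m) = a • M.proj (i - k) m := by
  classical
  obtain ⟨t, ht, hm⟩ := M.proj_sum m
  conv_lhs => rw [← hm, Finset.smul_sum, map_sum]
  have h : ∀ j ∈ t, M.proj i (a • M.proj j m) =
      if j = i - k then a • M.proj (i - k) m else 0 := by
    intro j _
    split_ifs with h
    · subst h
      refine M.proj_same _ _ ?_
      have := M.smul_mem k (i - k) a _ ha (M.proj_mem _ m)
      rwa [add_sub_cancel] at this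
    · exact M.proj_ne _ _ (fun h' => h (by omega)) _ (M.smul_mem k j a _ ha (M.proj_mem _ m))
  rw [Finset.sum_congr rfl h, Finset.sum_ite_eq']
  split_ifs with hi
  · rfl
  · rw [ht _ hi, smul_zero]

/-- The zero module. -/
protected abbrev zero : GrMod F W where
  carrier := PUnit
  deg _ := ⊤
  isInternal := isInternal_of_proj _ (fun _ => 0) (fun _ _ => trivial) (fun _ _ _ => rfl)
    (fun _ _ _ _ _ => rfl) (fun _ => ⟨∅, fun _ _ => rfl, rfl⟩)
  smul_mem _ _ _ _ _ _ := trivial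

/-- A finite direct sum of graded modules, as a product. -/
protected abbrev pi {I : Type u} [Finite I] (M : I → GrMod F W) : GrMod F W where
  carrier := ∀ x, M x
  deg i := AddSubgroup.pi Set.univ fun x => (M x).deg i
  isInternal := by
    classical
    cases nonempty_fintype I
    refine isInternal_of_proj _
      (fun i => AddMonoidHom.pi fun x => ((M x).proj i).comp (Pi.evalAddMonoidHom _ x)) ?_ ?_ ?_ ?_
    · intro i m x _
      exact (M x).proj_mem _ _
    · intro i m hm
      funext x
      exact (M x).proj_same _ _ (hm x trivial)
    · intro i j hij m hm
      funext x
      exact (M x).proj_ne _ _ hij _ (hm x trivial)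
    · intro m
      choose t ht hm using fun x => (M x).proj_sum (m x)
      refine ⟨Finset.univ.biUnion t, ?_, ?_⟩
      · intro i hi
        funext x
        exact ht x i fun h => hi (Finset.mem_biUnion.2 ⟨x, Finset.mem_univ _, h⟩)
      · funext x
        rw [Finset.sum_apply]
        conv_rhs => rw [← hm x]
        refine (Finset.sum_subset ?_ fun i _ hi => ht x i hi).symm
        exact Finset.subset_biUnion_of_mem t (Finset.mem_univ x)
  smul_mem i j a m ha hm x _ := (M x).smul_mem i j a _ ha (hm x trivial)

/-- A homogeneous submodule of a graded module. -/
protected abbrev sub (M : GrMod F W) (K : Submodule (SymmetricAlgebra F W) M)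
    (hK : ∀ i, ∀ m ∈ K, M.proj i m ∈ K) : GrMod F W where
  carrier := K
  deg i := (M.deg i).comap K.subtype.toAddMonoidHom
  isInternal := by
    refine isInternal_of_proj _
      (fun i => (((M.proj i).comp K.subtype.toAddMonoidHom).codRestrict K.toAddSubgroup
        fun m => hK i m m.2)) ?_ ?_ ?_ ?_
    · intro i m
      exact M.proj_mem _ _
    · intro i m hm
      exact Subtype.ext (M.proj_same _ _ hm)
    · intro i j hij m hm
      exact Subtype.ext (M.proj_ne _ _ hij _ hm)
    · intro m
      obtain ⟨t, ht, hm⟩ := M.proj_sum m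
      refine ⟨t, fun i hi => Subtype.ext (ht i hi), Subtype.ext ?_⟩
      rw [AddSubmonoidClass.coe_finsetSum]
      exact hm
  smul_mem i j a m ha hm := M.smul_mem i j a _ ha hm

/-- A homomorphism with values in a homogeneous submodule, as a homomorphism to it. -/
protected def codRestrict {M N : GrMod F W} (f : M →ₗ[SymmetricAlgebra F W] N)
    (K : Submodule (SymmetricAlgebra F W) N) (hK : ∀ i, ∀ m ∈ K, N.proj i m ∈ K)
    (h : ∀ m, f m ∈ K) : M →ₗ[SymmetricAlgebra F W] N.sub K hK :=
  LinearMap.codRestrict K f h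

/-- The quotient of a graded module by a homogeneous submodule. -/
protected abbrev quot (M : GrMod F W) (K : Submodule (SymmetricAlgebra F W) M)
    (hK : ∀ i, ∀ m ∈ K, M.proj i m ∈ K) : GrMod F W where
  carrier := M ⧸ K
  deg i := (M.deg i).map K.mkQ.toAddMonoidHom
  isInternal := by
    refine isInternal_of_proj _
      (fun i => QuotientAddGroup.map K.toAddSubgroup K.toAddSubgroup (M.proj i)
        fun m hm => hK i m hm) ?_ ?_ ?_ ?_
    · intro i m
      obtain ⟨m, rfl⟩ := K.mkQ_surjective m
      exact ⟨M.proj i m, M.proj_mem _ _, rfl⟩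
    · rintro i _ ⟨m, hm, rfl⟩
      exact congrArg K.mkQ (M.proj_same _ _ hm)
    · rintro i j hij _ ⟨m, hm, rfl⟩
      exact (congrArg K.mkQ (M.proj_ne _ _ hij _ hm)).trans (map_zero _)
    · intro m
      obtain ⟨m, rfl⟩ := K.mkQ_surjective m
      obtain ⟨t, ht, hm⟩ := M.proj_sum m
      refine ⟨t, fun i hi => (congrArg K.mkQ (ht i hi)).trans (map_zero _), ?_⟩
      conv_rhs => rw [← hm, map_sum]
      rfl
  smul_mem := by
    rintro i j a _ ha ⟨m, hm, rfl⟩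
    exact ⟨a • m, M.smul_mem i j a _ ha hm, rfl⟩

end GrMod

/-! The symmetric algebra as a graded module over itself. -/

/-- The coaction `S → S[X]`, `w ↦ w X` for `w ∈ W`, whose coefficients are the projections. -/
def symCoaction : SymmetricAlgebra F W →ₐ[F] Polynomial (SymmetricAlgebra F W) :=
  SymmetricAlgebra.lift ((LinearMap.restrictScalars F
    (Polynomial.monomial (R := SymmetricAlgebra F W) 1)) ∘ₗ SymmetricAlgebra.ι F W)

theorem symCoaction_ι (w : W) : symCoaction (SymmetricAlgebra.ι F W w) =
    Polynomial.monomial 1 (SymmetricAlgebra.ι F W w) := by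
  simp [symCoaction]

theorem symCoaction_pow (k : ℕ) (a : SymmetricAlgebra F W)
    (ha : a ∈ (LinearMap.range (SymmetricAlgebra.ι F W)) ^ k) :
    symCoaction a = Polynomial.monomial k a := by
  induction ha using Submodule.pow_induction_on_left' with
  | algebraMap r =>
    rw [AlgHom.commutes, Polynomial.algebraMap_apply]
    rfl
  | add x y i hx hy hx' hy' => rw [map_add, map_add, hx', hy']
  | mem_mul m hm i x hx hx' =>
    obtain ⟨w, rfl⟩ := hm
    rw [map_mul, hx', symCoaction_ι, Polynomial.monomial_mul_monomial, add_comm]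

theorem symCoaction_coeff_mem (a : SymmetricAlgebra F W) (k : ℕ) :
    (symCoaction a).coeff k ∈ (LinearMap.range (SymmetricAlgebra.ι F W)) ^ k := by
  induction a using SymmetricAlgebra.induction generalizing k with
  | algebraMap r =>
    rw [AlgHom.commutes, Polynomial.algebraMap_apply, Polynomial.coeff_C]
    split_ifs with h
    · subst h
      rw [pow_zero]
      exact Submodule.algebraMap_mem r
    · exact zero_mem _
  | ι w =>
    rw [symCoaction_ι, Polynomial.coeff_monomial]
    split_ifs with h
    · subst h
      rw [pow_one]
      exact ⟨w, rfl⟩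
    · exact zero_mem _
  | mul a b ha hb =>
    rw [map_mul, Polynomial.coeff_mul]
    refine Submodule.sum_mem _ fun x hx => ?_
    rw [← Finset.HasAntidiagonal.mem_antidiagonal.1 hx, pow_add]
    exact Submodule.mul_mem_mul (ha _) (hb _)
  | add a b ha hb =>
    rw [map_add, Polynomial.coeff_add]
    exact add_mem (ha k) (hb k)

theorem symCoaction_eval (a : SymmetricAlgebra F W) : (symCoaction a).eval 1 = a := by
  induction a using SymmetricAlgebra.induction with
  | algebraMap r => rw [AlgHom.commutes, Polynomial.algebraMap_apply, Polynomial.eval_C]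
  | ι w => rw [symCoaction_ι, Polynomial.eval_monomial]; simp
  | mul a b ha hb => rw [map_mul, Polynomial.eval_mul, ha, hb]
  | add a b ha hb => rw [map_add, Polynomial.eval_add, ha, hb]

theorem symDeg_two_mul (k : ℕ) :
    symDeg F W (2 * k) = (LinearMap.range (SymmetricAlgebra.ι F W)) ^ k := by
  rw [symDeg, if_pos ⟨by positivity, even_two_mul _⟩]
  congr 1
  omega

theorem ι_mem_symDeg (w : W) : SymmetricAlgebra.ι F W w ∈ symDeg F W 2 := by
  have := symDeg_two_mul (F := F) (W := W) 1
  rw [pow_one] at this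
  rw [show (2 : ℤ) = 2 * (1 : ℕ) from rfl, this]
  exact ⟨w, rfl⟩

variable (F W) in
/-- The symmetric algebra, as a graded module over itself. -/
abbrev GrMod.sym : GrMod F W where
  carrier := SymmetricAlgebra F W
  deg i := (symDeg F W i).toAddSubgroup
  isInternal := by
    classical
    have hcases : ∀ i : ℤ, (∃ k : ℕ, i = 2 * k) ∨ symDeg F W i = ⊥ := by
      intro i
      by_cases h : 0 ≤ i ∧ Even i
      · obtain ⟨h0, r, hr⟩ := h
        exact Or.inl ⟨r.toNat, by omega⟩
      · exact Or.inr (if_neg h)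
    refine isInternal_of_proj _
      (fun i => if 0 ≤ i ∧ Even i then
        ((Polynomial.lcoeff (SymmetricAlgebra F W) (i / 2).toNat).toAddMonoidHom).comp
          (symCoaction (F := F) (W := W)).toRingHom.toAddMonoidHom else 0) ?_ ?_ ?_ ?_
    · intro i m
      change _ ∈ symDeg F W i
      rw [symDeg]
      split_ifs
      · exact symCoaction_coeff_mem m _
      · exact zero_mem _
    · intro i m hm
      change m ∈ symDeg F W i at hm
      rw [symDeg] at hm
      split_ifs at hm ⊢ with h
      · change (symCoaction m).coeff _ = m
        rw [symCoaction_pow _ m hm, Polynomial.coeff_monomial_same]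
      · rw [(Submodule.mem_bot F).1 hm, map_zero]
    · intro i j hij m hm
      change m ∈ symDeg F W i at hm
      rcases hcases i with ⟨k, rfl⟩ | h
      · rw [symDeg_two_mul] at hm
        split_ifs with h
        · change (symCoaction m).coeff _ = 0
          rw [symCoaction_pow _ m hm, Polynomial.coeff_monomial_of_ne]
          obtain ⟨h0, r, hr⟩ := h
          omega
        · rfl
      · rw [h] at hm
        rw [(Submodule.mem_bot F).1 hm, map_zero]
    · intro m
      refine ⟨(symCoaction m).support.image fun k : ℕ => (2 * k : ℤ), ?_, ?_⟩
      · intro i hi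
        split_ifs with h
        · change (symCoaction m).coeff _ = 0
          by_contra hne
          obtain ⟨h0, r, hr⟩ := h
          exact hi (Finset.mem_image.2 ⟨_, Polynomial.mem_support_iff.2 hne, by omega⟩)
        · rfl
      · rw [Finset.sum_image fun a _ b _ h => by simpa using h]
        conv_rhs => rw [← symCoaction_eval m, Polynomial.eval_eq_sum, Polynomial.sum]
        refine Finset.sum_congr rfl fun k _ => ?_
        rw [if_pos ⟨by positivity, even_two_mul _⟩, one_pow, mul_one]
        change (symCoaction m).coeff _ = _
        congr 1
        omega
  smul_mem i j a m ha hm := by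
    change a * m ∈ symDeg F W (i + j)
    change m ∈ symDeg F W j at hm
    have hcases : ∀ i : ℤ, (∃ k : ℕ, i = 2 * k) ∨ symDeg F W i = ⊥ := by
      intro i
      by_cases h : 0 ≤ i ∧ Even i
      · obtain ⟨h0, r, hr⟩ := h
        exact Or.inl ⟨r.toNat, by omega⟩
      · exact Or.inr (if_neg h)
    rcases hcases i with ⟨k, rfl⟩ | h
    · rcases hcases j with ⟨n, rfl⟩ | h'
      · rw [symDeg_two_mul] at ha hm
        have : (2 * k + 2 * n : ℤ) = 2 * ((k + n : ℕ) : ℤ) := by push_cast; ring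
        rw [this, symDeg_two_mul, pow_add]
        exact Submodule.mul_mem_mul ha hm
      · rw [h'] at hm
        rw [(Submodule.mem_bot F).1 hm, mul_zero]
        exact zero_mem _
    · rw [h] at ha
      rw [(Submodule.mem_bot F).1 ha, zero_mul]
      exact zero_mem _

end Graded

/-! ### Sheaves on moment graphs -/

section Sheaves

/-- The oriented labelled graph underlying a moment graph with labels in `W`. An edge `e` goes from
`src e` to `tgt e`. (The order on the vertices enters the notion of a sheaf only through the
orientation of the edges.) -/
structure LabelledGraph (W : Type u) where
  Vert : Type u
  Edge : Type u
  src : Edge → Vert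
  tgt : Edge → Vert
  label : Edge → W

variable {F : Type u} [Field F] {W : Type u} [AddCommGroup W] [Module F W]

namespace LabelledGraph

/-- `G.Inc x e`: the vertex `x` lies on the edge `e`, being its source or its target. -/
inductive Inc (G : LabelledGraph W) : G.Vert → G.Edge → Type u
  | src (e : G.Edge) : Inc G (G.src e) e
  | tgt (e : G.Edge) : Inc G (G.tgt e) e

variable (F) in
/-- The GKM-property of the full subgraph on the set of vertices `I`: the labels of any two of its
edges that have a common vertex are not proportional. -/
def GKM (G : LabelledGraph W) (I : Set G.Vert) : Prop :=
  ∀ e e' : G.Edge, G.src e ∈ I → G.tgt e ∈ I → G.src e' ∈ I → G.tgt e' ∈ I → e ≠ e' →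
    (∃ x, Nonempty (G.Inc x e) ∧ Nonempty (G.Inc x e')) → ∀ c : F, G.label e' ≠ c • G.label e

variable (F) in
/-- The local structure algebra `𝒵(I)`: the sections over `I` of the structure sheaf, which has
stalks `S`, edge modules `S / l(e) S` and the natural projections as restrictions. -/
def structureAlgebra (G : LabelledGraph W) (I : Set G.Vert) :
    Subalgebra (SymmetricAlgebra F W) (I → SymmetricAlgebra F W) where
  carrier := {z | ∀ (e : G.Edge) (hs : G.src e ∈ I) (ht : G.tgt e ∈ I),
    SymmetricAlgebra.ι F W (G.label e) ∣ z ⟨_, hs⟩ - z ⟨_, ht⟩}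
  mul_mem' := by
    intro y z hy hz e hs ht
    have : (y * z) ⟨_, hs⟩ - (y * z) ⟨_, ht⟩ =
        (y ⟨_, hs⟩ - y ⟨_, ht⟩) * z ⟨_, hs⟩ + y ⟨_, ht⟩ * (z ⟨_, hs⟩ - z ⟨_, ht⟩) := by
      simp only [Pi.mul_apply]
      ring
    rw [this]
    exact dvd_add ((hy e hs ht).mul_right _) ((hz e hs ht).mul_left _)
  add_mem' := by
    intro y z hy hz e hs ht
    have : (y + z) ⟨_, hs⟩ - (y + z) ⟨_, ht⟩ =
        (y ⟨_, hs⟩ - y ⟨_, ht⟩) + (z ⟨_, hs⟩ - z ⟨_, ht⟩) := by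
      simp only [Pi.add_apply]
      ring
    rw [this]
    exact dvd_add (hy e hs ht) (hz e hs ht)
  algebraMap_mem' := by
    intro r e hs ht
    simp

end LabelledGraph

variable (F) in
/-- A sheaf on a moment graph. -/
structure Sheaf (G : LabelledGraph W) where
  stalk : G.Vert → GrMod F W
  edge : G.Edge → GrMod F W
  label_smul : ∀ (e : G.Edge) (m : edge e), SymmetricAlgebra.ι F W (G.label e) • m = 0
  /-- the restriction from the source of an edge -/
  resSrc : ∀ e : G.Edge, stalk (G.src e) →ₗ[SymmetricAlgebra F W] edge e
  /-- the restriction from the target of an edge -/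
  resTgt : ∀ e : G.Edge, stalk (G.tgt e) →ₗ[SymmetricAlgebra F W] edge e
  resSrc_deg : ∀ e i, ∀ m ∈ (stalk (G.src e)).deg i, resSrc e m ∈ (edge e).deg i
  resTgt_deg : ∀ e i, ∀ m ∈ (stalk (G.tgt e)).deg i, resTgt e m ∈ (edge e).deg i

namespace Sheaf

variable {G : LabelledGraph W} (M : Sheaf F G)

/-- The restriction `ρ_{x,e}` for a vertex `x` lying on the edge `e`. -/
def res : ∀ {x : G.Vert} {e : G.Edge}, G.Inc x e → M.stalk x →ₗ[SymmetricAlgebra F W] M.edge e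
  | _, _, .src e => M.resSrc e
  | _, _, .tgt e => M.resTgt e

/-- The support. -/
def supp : Set G.Vert := {x | ∃ m : M.stalk x, m ≠ 0}

/-- The costalk `M_x` of a sheaf at `x`, as a submodule of the stalk `M^x`. -/
def costalk (x : G.Vert) : Submodule (SymmetricAlgebra F W) (M.stalk x) where
  carrier := {m | ∀ (e : G.Edge) (h : G.Inc x e), M.res h m = 0}
  add_mem' := by
    intro m n hm hn e h
    rw [map_add, hm, hn, add_zero]
  zero_mem' := by
    intro e h
    rw [map_zero]
  smul_mem' := by
    intro a m hm e h
    rw [map_smul, hm, smul_zero]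

/-- The sections over a set of vertices `I`. -/
def sections (I : Set G.Vert) : Submodule (SymmetricAlgebra F W) (∀ x : I, M.stalk x) where
  carrier := {m | ∀ (e : G.Edge) (hs : G.src e ∈ I) (ht : G.tgt e ∈ I),
    M.resSrc e (m ⟨_, hs⟩) = M.resTgt e (m ⟨_, ht⟩)}
  add_mem' := by
    intro m n hm hn e hs ht
    rw [Pi.add_apply, Pi.add_apply, map_add, map_add, hm, hn]
  zero_mem' := by
    intro e hs ht
    rw [Pi.zero_apply, Pi.zero_apply, map_zero, map_zero]
  smul_mem' := by
    intro a m hm e hs ht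
    rw [Pi.smul_apply, Pi.smul_apply, map_smul, map_smul, hm]

/-- The global sections `Γ(M)`. -/
def globalSections : Submodule (SymmetricAlgebra F W) (∀ x : G.Vert, M.stalk x) where
  carrier := {m | ∀ e : G.Edge, M.resSrc e (m (G.src e)) = M.resTgt e (m (G.tgt e))}
  add_mem' := by
    intro m n hm hn e
    rw [Pi.add_apply, Pi.add_apply, map_add, map_add, hm, hn]
  zero_mem' := by
    intro e
    rw [Pi.zero_apply, Pi.zero_apply, map_zero, map_zero]
  smul_mem' := by
    intro a m hm e
    rw [Pi.smul_apply, Pi.smul_apply, map_smul, map_smul, hm]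

open Classical in
/-- The action of `𝒵(I)` on `Γ(M)` for a sheaf `M` with support in `I`: it is `(z m)_x = z_x m_x`
for `x ∈ I`, and `(z m)_x = 0` for `x ∉ I`, where the stalk is zero. -/
def structureAct {I : Set G.Vert} (hM : M.supp ⊆ I) (z : G.structureAlgebra F I)
    (m : M.globalSections) : M.globalSections :=
  ⟨fun x => if h : x ∈ I then z.1 ⟨x, h⟩ • m.1 x else 0, by
    intro e
    have h0 : ∀ x, x ∉ I → m.1 x = 0 := fun x hx => by
      by_contra hne
      exact hx (hM ⟨_, hne⟩)
    have hm := m.2 e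
    beta_reduce
    by_cases hs : G.src e ∈ I <;> by_cases ht : G.tgt e ∈ I
    · rw [dif_pos hs, dif_pos ht, map_smul, map_smul, hm, ← sub_eq_zero, ← sub_smul]
      obtain ⟨d, hd⟩ := z.2 e hs ht
      rw [hd, mul_comm, mul_smul, M.label_smul, smul_zero]
    · rw [dif_pos hs, dif_neg ht, map_smul, hm, h0 _ ht, map_zero, smul_zero]
    · rw [dif_neg hs, dif_pos ht, map_smul, ← hm, h0 _ hs, map_zero, smul_zero]
    · rw [dif_neg hs, dif_neg ht, map_zero, map_zero]⟩

/-- Transport of stalks along an equality of vertices. -/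
def castStalk {x y : G.Vert} (h : x = y) : M.stalk x →ₗ[SymmetricAlgebra F W] M.stalk y :=
  h ▸ LinearMap.id

theorem castStalk_deg {x y : G.Vert} (h : x = y) (i : ℤ) (m : M.stalk x)
    (hm : m ∈ (M.stalk x).deg i) : M.castStalk h m ∈ (M.stalk y).deg i := by
  subst h
  exact hm

end Sheaf

end Sheaves

/-! ### The affine Weyl group and its moment graph -/

section Affine

variable {ι V N : Type u} [AddCommGroup V] [Module ℚ V] [AddCommGroup N] [Module ℚ N]
  (P : RootPairing ι ℚ V N)

/-- The weight lattice `X ⊆ V`. -/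
def weightLattice : Submodule ℤ V where
  carrier := {v | ∀ i, ∃ n : ℤ, P.toLinearMap v (P.coroot i) = n}
  add_mem' := by
    intro v w hv hw i
    obtain ⟨n, hn⟩ := hv i
    obtain ⟨k, hk⟩ := hw i
    exact ⟨n + k, by rw [map_add, LinearMap.add_apply, hn, hk]; push_cast; rfl⟩
  zero_mem' := fun i => ⟨0, by simp⟩
  smul_mem' := by
    intro a v hv i
    obtain ⟨n, hn⟩ := hv i
    exact ⟨a * n, by rw [map_zsmul, LinearMap.smul_apply, hn]; simp⟩

/-- The affine weight lattice `X ⊕ ℤ` in `V ⊕ ℚ`. -/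
def affineWeights : Submodule ℤ (V × ℚ) :=
  (weightLattice P).prod (LinearMap.range (Algebra.linearMap ℤ ℚ))

/-- The vector `(α, n)` of `V ⊕ ℚ` for an affine root. Affine roots are indexed by `ι × ℤ`. -/
def affineRoot (γ : ι × ℤ) : V × ℚ := (P.root γ.1, (γ.2 : ℚ))

theorem affineRoot_mem [P.IsCrystallographic] (γ : ι × ℤ) : affineRoot P γ ∈ affineWeights P := by
  refine ⟨fun i => ?_, γ.2, rfl⟩
  obtain ⟨n, hn⟩ := RootPairing.IsValuedIn.exists_value (P := P) (S := ℤ) γ.1 i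
  exact ⟨n, hn.symm⟩

/-- The affine reflection `v ↦ v - (⟨α, v⟩ + n) α^∨` of `V^*` (realised as `N`) attached to the
affine root `(α, n)`. -/
def affineReflection (γ : ι × ℤ) : N ≃ᵃ[ℚ] N :=
  (P.coreflection γ.1).toAffineEquiv.trans
    (AffineEquiv.constVAdd ℚ N (-((γ.2 : ℚ) • P.coroot γ.1)))

theorem affineReflection_apply (γ : ι × ℤ) (v : N) : affineReflection P γ v =
    v - (P.toLinearMap (P.root γ.1) v + γ.2) • P.coroot γ.1 := by
  change -((γ.2 : ℚ) • P.coroot γ.1) + P.coreflection γ.1 v = _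
  rw [P.coreflection_apply, add_smul]
  abel

theorem affineReflection_mul_self (γ : ι × ℤ) :
    affineReflection P γ * affineReflection P γ = 1 := by
  ext v
  change affineReflection P γ (affineReflection P γ v) = v
  rw [affineReflection_apply, affineReflection_apply, map_sub, map_smul, P.root_coroot_two,
    smul_eq_mul, sub_sub, ← add_smul]
  convert sub_zero v
  convert zero_smul ℚ (P.coroot γ.1)
  ring

theorem affineReflection_inv (γ : ι × ℤ) : (affineReflection P γ)⁻¹ = affineReflection P γ :=
  inv_eq_of_mul_eq_one_left (affineReflection_mul_self P γ)

/-- The affine Weyl group. -/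
def affineWeylGroup : Subgroup (N ≃ᵃ[ℚ] N) :=
  Subgroup.closure (Set.range (affineReflection P))

/-- The affine reflections as elements of the affine Weyl group. -/
def refl (γ : ι × ℤ) : affineWeylGroup P :=
  ⟨affineReflection P γ, Subgroup.subset_closure ⟨γ, rfl⟩⟩

theorem refl_mul_self (γ : ι × ℤ) : refl P γ * refl P γ = 1 :=
  Subtype.ext (affineReflection_mul_self P γ)

/-- The action of affine transformations `g` of `V^*` on `V ⊕ ℚ`: regarding `(λ, k)` as the affine
function `v ↦ ⟨λ, v⟩ + k`, it is `f ↦ f ∘ g⁻¹`. -/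
def affineAct (g : N ≃ᵃ[ℚ] N) (ν : V × ℚ) : V × ℚ :=
  (P.toLinearMap.toPerfPair.symm (P.toLinearMap ν.1 ∘ₗ ((g⁻¹ : N ≃ᵃ[ℚ] N).linear : N →ₗ[ℚ] N)),
    ν.2 + P.toLinearMap ν.1 ((g⁻¹ : N ≃ᵃ[ℚ] N) 0))

theorem affineAct_spec (g : N ≃ᵃ[ℚ] N) (ν : V × ℚ) (v : N) :
    P.toLinearMap (affineAct P g ν).1 v + (affineAct P g ν).2 =
      P.toLinearMap ν.1 ((g⁻¹ : N ≃ᵃ[ℚ] N) v) + ν.2 := by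
  have h : (g⁻¹ : N ≃ᵃ[ℚ] N) v = (g⁻¹ : N ≃ᵃ[ℚ] N).linear v + (g⁻¹ : N ≃ᵃ[ℚ] N) 0 := by
    have := (g⁻¹ : N ≃ᵃ[ℚ] N).map_vadd 0 v
    simpa using this
  rw [h, affineAct, map_add]
  simp only [LinearMap.apply_symm_toPerfPair_self, LinearMap.comp_apply]
  change P.toLinearMap ν.1 ((g⁻¹ : N ≃ᵃ[ℚ] N).linear v) + _ = _
  ring

theorem affineFun_ext {μ ν : V × ℚ}
    (h : ∀ v, P.toLinearMap μ.1 v + μ.2 = P.toLinearMap ν.1 v + ν.2) : μ = ν := by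
  have h2 : μ.2 = ν.2 := by simpa using h 0
  refine Prod.ext (P.toLinearMap.toPerfPair.injective (LinearMap.ext fun v => ?_)) h2
  have := h v
  rw [h2] at this
  exact add_right_cancel this

theorem affineAct_one (ν : V × ℚ) : affineAct P 1 ν = ν :=
  affineFun_ext P fun v => by rw [affineAct_spec, inv_one]; rfl

theorem affineAct_mul (g h : N ≃ᵃ[ℚ] N) (ν : V × ℚ) :
    affineAct P (g * h) ν = affineAct P g (affineAct P h ν) :=
  affineFun_ext P fun v => by
    rw [affineAct_spec, affineAct_spec, affineAct_spec, mul_inv_rev]; rfl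

theorem affineAct_reflection (γ : ι × ℤ) (ν : V × ℚ) :
    affineAct P (affineReflection P γ) ν =
      ν - P.toLinearMap ν.1 (P.coroot γ.1) • affineRoot P γ :=
  affineFun_ext P fun v => by
    rw [affineAct_spec, affineReflection_inv, affineReflection_apply, map_sub, map_smul]
    simp only [affineRoot, Prod.fst_sub, Prod.snd_sub, Prod.smul_fst, Prod.smul_snd, map_sub,
      map_smul, LinearMap.sub_apply, LinearMap.smul_apply, smul_eq_mul]
    ring

theorem affineAct_mem [P.IsCrystallographic] (w : affineWeylGroup P) (ν : V × ℚ)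
    (hν : ν ∈ affineWeights P) : affineAct P w ν ∈ affineWeights P := by
  have key : ∀ γ, ∀ μ ∈ affineWeights P, affineAct P (affineReflection P γ) μ ∈ affineWeights P := by
    intro γ μ hμ
    rw [affineAct_reflection]
    obtain ⟨n, hn⟩ := hμ.1 γ.1
    rw [hn, Int.cast_smul_eq_zsmul]
    exact sub_mem hμ (Submodule.smul_mem _ _ (affineRoot_mem P γ))
  obtain ⟨w, hw⟩ := w
  change affineAct P w ν ∈ _
  induction hw using Subgroup.closure_induction'' generalizing ν with
  | one => rwa [affineAct_one]
  | mem x hx => obtain ⟨γ, rfl⟩ := hx; exact key γ ν hν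
  | inv_mem x hx => obtain ⟨γ, rfl⟩ := hx; rw [affineReflection_inv]; exact key γ ν hν
  | mul x y _ _ ihx ihy => rw [affineAct_mul]; exact ihx _ (ihy _ hν)

/-- The action of the affine Weyl group on affine weights. -/
def weylAct [P.IsCrystallographic] (w : affineWeylGroup P) (ν : affineWeights P) :
    affineWeights P :=
  ⟨affineAct P w ν, affineAct_mem P w ν ν.2⟩

variable {P} (b : P.Base)

/-- The positive affine roots: `(α, n)` with `n > 0`, and `(α, 0)` with `α` positive. -/
def IsPositive (γ : ι × ℤ) : Prop := 0 < γ.2 ∨ (γ.2 = 0 ∧ b.IsPos γ.1)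

/-- `θ` is the highest root. -/
def IsHighest (θ : ι) : Prop :=
  ∀ i, P.root θ - P.root i ∈ AddSubmonoid.closure (P.root '' b.support)

/-- The simple affine roots: `(α, 0)` with `α` simple, and `(-θ, 1)` with `θ` the highest root. -/
def IsSimple (γ : ι × ℤ) : Prop :=
  (γ.2 = 0 ∧ γ.1 ∈ b.support) ∨ (γ.2 = 1 ∧ ∃ θ, IsHighest b θ ∧ P.root γ.1 = -P.root θ)

/-- The simple reflections. -/
def simpleReflections : Set (affineWeylGroup P) := {w | ∃ γ, IsSimple b γ ∧ refl P γ = w}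

/-- The simple affine root `α` with `s = s_α`. -/
def simpleRoot (s : simpleReflections b) : ι × ℤ := s.2.choose

theorem simpleRoot_spec (s : simpleReflections b) :
    IsSimple b (simpleRoot b s) ∧ refl P (simpleRoot b s) = s :=
  s.2.choose_spec

theorem simple_mul_self (s : simpleReflections b) :
    (s : affineWeylGroup P) * (s : affineWeylGroup P) = 1 := by
  rw [← (simpleRoot_spec b s).2, refl_mul_self]

/-- The length function with respect to the simple reflections. -/
def length (w : affineWeylGroup P) : ℕ :=
  sInf {n | ∃ L : List (affineWeylGroup P),
    (∀ s ∈ L, s ∈ simpleReflections b) ∧ L.prod = w ∧ L.length = n}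

/-- The strict Bruhat order: `x < y` if there is a chain `x = x₀, x₁, …, x_k = y` with `k ≥ 1` in
which each element is obtained from the preceding one by multiplication by a reflection and has
greater length. -/
def BruhatLT : affineWeylGroup P → affineWeylGroup P → Prop :=
  Relation.TransGen fun u w => ∃ γ, w = refl P γ * u ∧ length b u < length b w

variable {b} (s : simpleReflections b)

/-- The left cosets `{x, x s}`. -/
abbrev Coset : Type u := affineWeylGroup P ⧸ Subgroup.zpowers (s : affineWeylGroup P)

/-- The natural projection `x ↦ {x, x s}`. -/
abbrev toCoset (x : affineWeylGroup P) : Coset s := QuotientGroup.mk x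

theorem toCoset_eq {x y : affineWeylGroup P} (h : toCoset s x = toCoset s y) :
    y = x ∨ y = x * s := by
  rw [QuotientGroup.eq, Subgroup.mem_zpowers_iff] at h
  obtain ⟨k, hk⟩ := h
  have h2 : (s : affineWeylGroup P) ^ (2 : ℤ) = 1 := by
    rw [zpow_two, simple_mul_self]
  rcases Int.even_or_odd' k with ⟨n, rfl | rfl⟩
  · left
    rw [zpow_mul, h2, one_zpow] at hk
    exact (inv_mul_eq_one.1 hk.symm).symm
  · right
    rw [zpow_add, zpow_mul, h2, one_zpow, one_mul, zpow_one] at hk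
    rw [hk, mul_inv_cancel_left]

/-- The two-element set `{x, x s}` of representatives of a coset. -/
def fibre (a : Coset s) : Set (affineWeylGroup P) := {x | toCoset s x = a}

instance (a : Coset s) : Finite (fibre s a) := by
  obtain ⟨x, rfl⟩ := QuotientGroup.mk_surjective a
  refine Set.Finite.subset (Set.toFinite {x, x * (s : affineWeylGroup P)}) fun y hy => ?_
  exact toCoset_eq s (Eq.symm hy)

/-- The product `ev σ` of a subsequence of `s`. A subsequence, in which some of the entries of `s`
are replaced by blanks, is given by `σ : Fin l → Bool`, where `σ i = true` if the entry `s i` is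
kept. -/
def ev {l : ℕ} (s : Fin l → simpleReflections b) (σ : Fin l → Bool) : affineWeylGroup P :=
  (List.ofFn fun i => if σ i then (s i : affineWeylGroup P) else 1).prod

/-- The set `J(s)` of the products of all subsequences. -/
def evSet {l : ℕ} (s : Fin l → simpleReflections b) : Set (affineWeylGroup P) :=
  Set.range (ev s)

theorem ev_succ {l : ℕ} (s : Fin (l + 1) → simpleReflections b) (σ : Fin (l + 1) → Bool) :
    ev s σ = ev (Fin.init s : Fin l → simpleReflections b) (Fin.init σ : Fin l → Bool) *
      if σ (Fin.last l) then (s (Fin.last l) : affineWeylGroup P) else 1 := by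
  rw [ev, List.ofFn_succ', List.prod_concat]
  rfl

variable (F : Type u) [Field F] [P.IsCrystallographic]

variable (P) in
/-- The space `(X ⊕ ℤ) ⊗ F` of labels. -/
abbrev LabelSpace : Type u := F ⊗[ℤ] affineWeights P

variable (P) in
/-- The image `ν ⊗ 1` of an affine weight in the label space. -/
def bar (ν : affineWeights P) : LabelSpace P F := 1 ⊗ₜ[ℤ] ν

variable (P) in
/-- The symmetric algebra `S` of the label space. -/
abbrev SymAlg : Type u := SymmetricAlgebra F (LabelSpace P F)

variable (b) in
/-- The moment graph of the affine Weyl group: there is an edge from `x` to `y` for each positive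
affine root `α` with `x < y` and `y = s_α x`; it has the label `α ⊗ 1`. -/
abbrev affineGraph : LabelledGraph (LabelSpace P F) where
  Vert := affineWeylGroup P
  Edge := {q : (affineWeylGroup P × affineWeylGroup P) × (ι × ℤ) //
    IsPositive b q.2 ∧ BruhatLT b q.1.1 q.1.2 ∧ q.1.2 = refl P q.2 * q.1.1}
  src e := e.1.1.1
  tgt e := e.1.1.2
  label e := bar P F ⟨affineRoot P e.1.2, affineRoot_mem P e.1.2⟩

/-- The quotient moment graph: there is an edge from `x̄` to `ȳ`, where `x̄ ≠ ȳ`, if there is an edge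
between representatives; it has the same label. -/
abbrev cosetGraph : LabelledGraph (LabelSpace P F) where
  Vert := Coset s
  Edge := {q : (Coset s × Coset s) × (ι × ℤ) // q.1.1 ≠ q.1.2 ∧
    ∃ e : (affineGraph b F).Edge, toCoset s e.1.1.1 = q.1.1 ∧ toCoset s e.1.1.2 = q.1.2 ∧
      e.1.2 = q.2}
  src e := e.1.1.1
  tgt e := e.1.1.2
  label e := bar P F ⟨affineRoot P e.1.2, affineRoot_mem P e.1.2⟩

variable {F}

/-- The edges of the moment graph lying over an edge `Ē` of the quotient moment graph: they are the
edges `E` and `E s`, where `E` is one of them. -/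
def Over (E : (cosetGraph s F).Edge) : Type u :=
  {e : (affineGraph b F).Edge //
    toCoset s e.1.1.1 = E.1.1.1 ∧ toCoset s e.1.1.2 = E.1.1.2 ∧ e.1.2 = E.1.2}

instance (E : (cosetGraph s F).Edge) : Finite (Over s E) := by
  refine Finite.of_injective (β := fibre s E.1.1.1) (fun e => ⟨e.1.1.1.1, e.2.1⟩) fun e e' h => ?_
  have h1 : e.1.1.1.1 = e'.1.1.1.1 := congrArg Subtype.val h
  have h2 : e.1.1.2 = e'.1.1.2 := e.2.2.2.trans e'.2.2.2.symm
  have h3 : e.1.1.1.2 = e'.1.1.1.2 := by rw [e.1.2.2.2, e'.1.2.2.2, h1, h2]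
  exact Subtype.ext (Subtype.ext (Prod.ext (Prod.ext h1 h3) h2))

/-! ### The translation functors -/

theorem GrMod.proj_pi {W : Type u} [AddCommGroup W] [Module F W] {I : Type u} [Finite I]
    (M : I → GrMod F W) (i : ℤ) (m : GrMod.pi M) (x : I) :
    (GrMod.pi M).proj i m x = (M x).proj i (m x) :=
  GrMod.map_proj (M := GrMod.pi M) (N := M x) (LinearMap.proj x) (fun _ _ hm => hm x trivial) i m

section On

variable (M : Sheaf F (affineGraph b F))

/-- The stalk `Γ({x, x s}, M)` of `ϑ_on M` at `x̄ = {x, x s}`. -/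
abbrev onStalk (a : Coset s) : GrMod F (LabelSpace P F) :=
  (GrMod.pi fun x : fibre s a => M.stalk x).sub (M.sections (fibre s a)) (by
    intro i m hm e hs ht
    rw [GrMod.proj_pi, GrMod.proj_pi, GrMod.map_proj _ (M.resSrc_deg e),
      GrMod.map_proj _ (M.resTgt_deg e), hm e hs ht])

/-- The module `M^E ⊕ M^{E s}` for an edge `Ē`. -/
abbrev onAmbient (E : (cosetGraph s F).Edge) : GrMod F (LabelSpace P F) :=
  GrMod.pi fun e : Over s E => M.edge e.1

/-- The map `ρ_{x,E} ⊕ ρ_{xs,Es}` on `Γ({x, x s}, M)`, where `x̄` is the source of `Ē`. -/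
def onSrc (E : (cosetGraph s F).Edge) :
    onStalk s M ((cosetGraph s F).src E) →ₗ[SymAlg P F] onAmbient s M E :=
  LinearMap.pi fun e : Over s E => M.resSrc e.1 ∘ₗ
    LinearMap.proj (R := SymAlg P F) (φ := fun x : fibre s E.1.1.1 => M.stalk x)
      ⟨e.1.1.1.1, e.2.1⟩ ∘ₗ (M.sections (fibre s E.1.1.1)).subtype

/-- The map `ρ_{y,E} ⊕ ρ_{ys,Es}` on `Γ({y, y s}, M)`, where `ȳ` is the target of `Ē`. -/
def onTgt (E : (cosetGraph s F).Edge) :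
    onStalk s M ((cosetGraph s F).tgt E) →ₗ[SymAlg P F] onAmbient s M E :=
  LinearMap.pi fun e : Over s E => M.resTgt e.1 ∘ₗ
    LinearMap.proj (R := SymAlg P F) (φ := fun x : fibre s E.1.1.2 => M.stalk x)
      ⟨e.1.1.1.2, e.2.2.1⟩ ∘ₗ (M.sections (fibre s E.1.1.2)).subtype

theorem onSrc_deg (E : (cosetGraph s F).Edge) (i : ℤ)
    (m : onStalk s M ((cosetGraph s F).src E)) (hm : m ∈ (onStalk s M _).deg i) :
    onSrc s M E m ∈ (onAmbient s M E).deg i :=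
  fun e _ => M.resSrc_deg e.1 i _ (hm ⟨e.1.1.1.1, e.2.1⟩ trivial)

theorem onTgt_deg (E : (cosetGraph s F).Edge) (i : ℤ)
    (m : onStalk s M ((cosetGraph s F).tgt E)) (hm : m ∈ (onStalk s M _).deg i) :
    onTgt s M E m ∈ (onAmbient s M E).deg i :=
  fun e _ => M.resTgt_deg e.1 i _ (hm ⟨e.1.1.1.2, e.2.2.1⟩ trivial)

/-- The module of `ϑ_on M` at an edge `Ē` from `x̄` to `ȳ`: the image of `Γ({y, y s}, M)`. -/
abbrev onEdge (E : (cosetGraph s F).Edge) : GrMod F (LabelSpace P F) :=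
  (onAmbient s M E).sub (LinearMap.range (onTgt s M E)) (by
    rintro i _ ⟨m, rfl⟩
    exact ⟨GrMod.proj _ i m, GrMod.map_proj _ (onTgt_deg s M E) i m⟩)

open Classical in
/-- The restriction to `Ē` from its source. If `M` is projective, the image of `onSrc` is contained
in the image of `onTgt`, and the restriction is `onSrc`. The functor `ϑ_on` is only meant for such
sheaves. -/
def onResSrc (E : (cosetGraph s F).Edge) :
    onStalk s M ((cosetGraph s F).src E) →ₗ[SymAlg P F] onEdge s M E :=
  if h : ∀ m, onSrc s M E m ∈ LinearMap.range (onTgt s M E) then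
    GrMod.codRestrict (onSrc s M E) _ _ h
  else 0

/-- The sheaf `ϑ_on M` on the quotient moment graph. -/
def thetaOn : Sheaf F (cosetGraph s F) where
  stalk := onStalk s M
  edge := onEdge s M
  label_smul := by
    intro E m
    refine Subtype.ext (funext fun e => ?_)
    have h := M.label_smul e.1 (m.1 e)
    have h2 : (affineGraph b F).label e.1 = (cosetGraph s F).label E := by
      simp only [e.2.2.2]
    rw [h2] at h
    exact h
  resSrc := onResSrc s M
  resTgt E := GrMod.codRestrict (onTgt s M E) _ _ fun m => ⟨m, rfl⟩
  resSrc_deg := by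
    intro E i m hm
    by_cases h : ∀ m, onSrc s M E m ∈ LinearMap.range (onTgt s M E)
    · rw [onResSrc, dif_pos h]
      exact onSrc_deg s M E i m hm
    · rw [onResSrc, dif_neg h]
      exact AddSubgroup.zero_mem _
  resTgt_deg E i m hm := onTgt_deg s M E i m hm

end On

section Out

/-- The edge `Ē` of the quotient moment graph given by an edge `E` that does not connect `x` and
`x s`. -/
def coverEdge (e : (affineGraph b F).Edge) (h : toCoset s e.1.1.1 ≠ toCoset s e.1.1.2) :
    (cosetGraph s F).Edge :=
  ⟨((toCoset s e.1.1.1, toCoset s e.1.1.2), e.1.2), h, e, rfl, rfl, rfl⟩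

variable (M : Sheaf F (cosetGraph s F))

/-- The module of `ϑ_out M` at an edge `E` from `x` to `y`: it is `M^x̄ / l(E) M^x̄` if `x̄ = ȳ`
(that is, `y = x s`), and `M^Ē` otherwise. -/
def outEdge (e : (affineGraph b F).Edge) :
    Decidable (toCoset s e.1.1.1 = toCoset s e.1.1.2) → GrMod F (LabelSpace P F)
  | .isTrue _ => (M.stalk (toCoset s e.1.1.1)).quot
      (LinearMap.range (LinearMap.lsmul (SymAlg P F) (M.stalk (toCoset s e.1.1.1))
        (SymmetricAlgebra.ι F (LabelSpace P F) ((affineGraph b F).label e)))) (by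
      rintro i _ ⟨m, rfl⟩
      exact ⟨GrMod.proj _ (i - 2) m, (GrMod.proj_smul _ _ 2 (ι_mem_symDeg _) i m).symm⟩)
  | .isFalse h => M.edge (coverEdge s e h)

/-- The restriction of `ϑ_out M` from the source of an edge. -/
def outSrc (e : (affineGraph b F).Edge) :
    ∀ d, M.stalk (toCoset s e.1.1.1) →ₗ[SymAlg P F] outEdge s M e d
  | .isTrue _ => Submodule.mkQ _
  | .isFalse h => M.resSrc (coverEdge s e h)

/-- The restriction of `ϑ_out M` from the target of an edge. -/
def outTgt (e : (affineGraph b F).Edge) :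
    ∀ d, M.stalk (toCoset s e.1.1.2) →ₗ[SymAlg P F] outEdge s M e d
  | .isTrue h => Submodule.mkQ _ ∘ₗ M.castStalk h.symm
  | .isFalse h => M.resTgt (coverEdge s e h)

/-- The sheaf `ϑ_out M` on the moment graph of the affine Weyl group. -/
def thetaOut : Sheaf F (affineGraph b F) where
  stalk x := M.stalk (toCoset s x)
  edge e := outEdge s M e (Classical.propDecidable _)
  label_smul := by
    intro e
    generalize Classical.propDecidable _ = d
    cases d with
    | isTrue h =>
      intro m
      obtain ⟨m, rfl⟩ := Submodule.mkQ_surjective _ m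
      exact (Submodule.Quotient.mk_eq_zero _).2 ⟨m, rfl⟩
    | isFalse h => exact M.label_smul (coverEdge s e h)
  resSrc e := outSrc s M e _
  resTgt e := outTgt s M e _
  resSrc_deg := by
    intro e
    generalize Classical.propDecidable _ = d
    cases d with
    | isTrue h => exact fun i m hm => ⟨m, hm, rfl⟩
    | isFalse h => exact M.resSrc_deg (coverEdge s e h)
  resTgt_deg := by
    intro e
    generalize Classical.propDecidable _ = d
    cases d with
    | isTrue h => exact fun i m hm => ⟨M.castStalk h.symm m, M.castStalk_deg _ i m hm, rfl⟩
    | isFalse h => exact M.resTgt_deg (coverEdge s e h)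

end Out

/-- The translation functor `ϑ^s = ϑ_out ∘ ϑ_on`. -/
def theta (M : Sheaf F (affineGraph b F)) : Sheaf F (affineGraph b F) :=
  thetaOut s (thetaOn s M)

/-! ### Bott–Samelson sheaves and the modules `X(s)` -/

variable (b F) in
open Classical in
/-- The sheaf `B(e)`: its stalk at the unit is `S`, everything else is zero. -/
def unitSheaf : Sheaf F (affineGraph b F) where
  stalk x := if x = 1 then GrMod.sym F (LabelSpace P F) else GrMod.zero
  edge _ := GrMod.zero
  label_smul _ _ := rfl
  resSrc _ := 0
  resTgt _ := 0
  resSrc_deg _ _ _ _ := trivial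
  resTgt_deg _ _ _ _ := trivial

variable (F) in
/-- The Bott–Samelson sheaf `B(s) = ϑ^{s_l} ⋯ ϑ^{s_1} B(e)` of a sequence of simple reflections. -/
def bottSamelson : ∀ {l : ℕ}, (Fin l → simpleReflections b) → Sheaf F (affineGraph b F)
  | 0, _ => unitSheaf b F
  | l + 1, s => theta (s (Fin.last l)) (bottSamelson (Fin.init s : Fin l → simpleReflections b))

variable (F) in
theorem supp_bottSamelson {l : ℕ} (s : Fin l → simpleReflections b) :
    (bottSamelson F s).supp ⊆ evSet s := by
  classical
  induction l with
  | zero =>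
    rintro x ⟨m, hm⟩
    refine ⟨Fin.elim0, ?_⟩
    by_contra hx
    have hx' : x ≠ 1 := fun h => hx (by rw [h]; simp [ev])
    change (if x = 1 then GrMod.sym F (LabelSpace P F) else GrMod.zero).carrier at m
    have : Subsingleton (if x = 1 then GrMod.sym F (LabelSpace P F) else GrMod.zero).carrier := by
      rw [if_neg hx']
      exact inferInstanceAs (Subsingleton PUnit)
    exact hm (this.elim _ _)
  | succ l ih =>
    rintro x ⟨m, hm⟩
    have : ∃ y : fibre (s (Fin.last l)) (toCoset (s (Fin.last l)) x), m.1 y ≠ 0 := by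
      by_contra h
      push Not at h
      exact hm (Subtype.ext (funext h))
    obtain ⟨⟨y, hy⟩, hmy⟩ := this
    obtain ⟨σ, hσ⟩ := ih (Fin.init s) ⟨_, hmy⟩
    simp only at hσ
    rcases toCoset_eq _ hy with rfl | rfl
    · exact ⟨Fin.snoc (α := fun _ => Bool) σ false, by simp [ev_succ, hσ]⟩
    · exact ⟨Fin.snoc (α := fun _ => Bool) σ true, by simp [ev_succ, hσ]⟩

variable (P F) in
/-- The module `⨁_{σ ∈ I(s)} S` for a sequence `s` of length `l`. -/
abbrev SeqModule (l : ℕ) : Type u := (Fin l → Bool) → SymAlg P F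

variable (P F) in
/-- The diagonal embedding `Δ`. -/
def diag (l : ℕ) : SeqModule P F l →ₗ[SymAlg P F] SeqModule P F (l + 1) :=
  LinearMap.funLeft (SymAlg P F) (SymAlg P F) fun σ : Fin (l + 1) → Bool =>
    (Fin.init σ : Fin l → Bool)

variable (F) in
/-- The action of `c^λ` on `⨁_{σ ∈ I(s)} S`: `(c^λ f)_σ` is the product of the image of
`ev(σ)(λ)` in `S` and `f_σ`. -/
def cAct {l : ℕ} (s : Fin l → simpleReflections b) (ν : affineWeights P) :
    SeqModule P F l →ₗ[SymAlg P F] SeqModule P F l :=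
  LinearMap.pi fun σ =>
    SymmetricAlgebra.ι F (LabelSpace P F) (bar P F (weylAct P (ev s σ) ν)) • LinearMap.proj σ

variable (F) in
/-- The module `X(s)`: `X(∅) = S` and `X(s) = Δ(X(s')) + c^{α_l} Δ(X(s'))`, where `s'` is `s`
without the last entry `s_l`, and `α_l` is the simple affine root with `s_l = s_{α_l}`. -/
def xModule : ∀ {l : ℕ}, (Fin l → simpleReflections b) →
    Submodule (SymAlg P F) (SeqModule P F l)
  | 0, _ => ⊤
  | l + 1, s =>
    (xModule (Fin.init s : Fin l → simpleReflections b)).map (diag P F l) ⊔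
      ((xModule (Fin.init s : Fin l → simpleReflections b)).map (diag P F l)).map
        (cAct F s ⟨affineRoot P (simpleRoot b (s (Fin.last l))), affineRoot_mem P _⟩)

variable (F) in
/-- The restriction of functions on `I(s)` to `I(s)_x = {σ | ev σ = x}`. -/
def restrictTo {l : ℕ} (s : Fin l → simpleReflections b) (x : affineWeylGroup P) :
    SeqModule P F l →ₗ[SymAlg P F] ({σ : Fin l → Bool // ev s σ = x} → SymAlg P F) :=
  LinearMap.funLeft (SymAlg P F) (SymAlg P F) Subtype.val

variable (F) in
/-- The module `X(s)^x` of the restrictions to `I(s)_x` of the elements of `X(s)`. -/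
def xStalk {l : ℕ} (s : Fin l → simpleReflections b) (x : affineWeylGroup P) :
    Submodule (SymAlg P F) ({σ : Fin l → Bool // ev s σ = x} → SymAlg P F) :=
  (xModule F s).map (restrictTo F s x)

variable (F) in
/-- The module `X(s)_x` of the restrictions to `I(s)_x` of the elements of `X(s)` that vanish
outside `I(s)_x`. -/
def xCostalk {l : ℕ} (s : Fin l → simpleReflections b) (x : affineWeylGroup P) :
    Submodule (SymAlg P F) ({σ : Fin l → Bool // ev s σ = x} → SymAlg P F) where
  carrier := {g | ∃ f ∈ xModule F s, (∀ σ, ev s σ ≠ x → f σ = 0) ∧ restrictTo F s x f = g}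
  add_mem' := by
    rintro _ _ ⟨f, hf, hf0, rfl⟩ ⟨g, hg, hg0, rfl⟩
    exact ⟨f + g, add_mem hf hg, fun σ h => by rw [Pi.add_apply, hf0 σ h, hg0 σ h, add_zero],
      map_add _ _ _⟩
  zero_mem' := ⟨0, zero_mem _, fun _ _ => rfl, map_zero _⟩
  smul_mem' := by
    rintro a _ ⟨f, hf, hf0, rfl⟩
    exact ⟨a • f, Submodule.smul_mem _ a hf,
      fun σ h => by rw [Pi.smul_apply, hf0 σ h, smul_zero], map_smul _ _ _⟩

variable (F) in
/-- A family of isomorphisms comparing the Bott–Samelson sheaf `B(s)` with `X(s)`: an isomorphism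
`φ` of `𝒵(J(s))`-modules from `Γ(B(s))` to `X(s)`, and isomorphisms `φ_x` of `S`-modules from the
stalks `B(s)^x` to `X(s)^x`, compatible with the restrictions. -/
structure Comparison {l : ℕ} (s : Fin l → simpleReflections b) where
  /-- the isomorphism `φ` -/
  glob : (bottSamelson F s).globalSections ≃ₗ[SymAlg P F] xModule F s
  glob_act : ∀ (z : (affineGraph b F).structureAlgebra F (evSet s))
    (m : (bottSamelson F s).globalSections) (σ : Fin l → Bool),
    (glob ((bottSamelson F s).structureAct (supp_bottSamelson F s) z m)).1 σ =
      z.1 ⟨ev s σ, σ, rfl⟩ * (glob m).1 σ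
  /-- the isomorphisms `φ_x` -/
  stalk : ∀ x : affineWeylGroup P, (bottSamelson F s).stalk x ≃ₗ[SymAlg P F] xStalk F s x
  comm : ∀ (x : affineWeylGroup P) (m : (bottSamelson F s).globalSections),
    (stalk x (m.1 x)).1 = restrictTo F s x (glob m).1

end Affine

end BottSamelson

end

noncomputable section

namespace BottSamelson

set_option linter.unusedSectionVars false

/-! ### Existence and properties of the highest root. -/

section HighestRoot

variable {ι V N : Type u} [AddCommGroup V] [Module ℚ V] [AddCommGroup N] [Module ℚ N]
  {P : RootPairing ι ℚ V N} {b : P.Base}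

/-! `B(s)` and `X(s)` are built by parallel recursions, and the heart of the proof matches one step:
if `M` is well behaved, the global sections of `ϑ^s M` are exactly the `Δ(a) + c^α Δ(c)` with `a`,
`c` global sections of `M` (`IsNice.exists_eq_add_twist`, `IsNice.add_twist_mem_globalSections`). A
section `m` of `ϑ^s M` gives two elements `m_x`, `m_xs` of `Γ({x, xs}, M)` congruent modulo `x(α)`;
`a` is half their sum, and `c` is half their difference divided by `x(α)`. Along an edge `E` between
different cosets, compatibility of `c` is obtained by cancelling `x(α)` in `M^E`. This is allowed
because `x(α)` is, up to sign, the label of the edge joining `x` and `xs`, hence not proportional to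
`l(E)` by the GKM-property. Conversely `c^ν` preserves sections, as `x(ν) ≡ y(ν)` modulo the label
of an edge from `x` to `y`.

"Well behaved" is `IsNice`: support in `J`, global sections surjecting onto stalks, torsion-freeness
of stalks and edge modules, and kernels of the restrictions from targets contained in `l(E) M^y`. It
holds for `B(e)` and passes to `ϑ^s M` (`IsNice.theta`) if `J` is stable under `x ↦ xs`, contains
the source of an edge whenever it contains the target, and is GKM; `J(s)` has the first two
properties for the last reflection. Niceness also shows that `ϑ_on` is applied only where its source
restriction is defined as intended (`IsNice.onSrc_mem_range`).

Iterating the step embeds each stalk `B(s)^x` into a sum of copies of `S` indexed by `I(s)_x`, with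
the global sections mapping onto `X(s)` (`exists_coordinates`); the comparison isomorphisms follow.
For costalks the argument is formal: an element of a costalk at `x` is the same as a global section
supported at `x`, and any comparison preserves supports (`Comparison.stalk_mem_xCostalk_iff`).

The combinatorial input is that for positive `β` there is an edge from `x` to `s_β x` exactly when
`x⁻¹(β)` is positive. It rests on the exchange condition and on the generation of the affine Weyl
group by the simple reflections, hence on the existence of a highest root. -/

theorem exists_root_eq_sum_nonneg {i : ι} (hi : b.IsPos i) :
    ∃ f : ι → ℤ, (∀ j, 0 ≤ f j) ∧ P.root i = ∑ j ∈ b.support, f j • P.root j := by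
  obtain ⟨f, hf, hf' | hf', h⟩ := b.exists_root_eq_sum_int i
  · exact ⟨f, fun j => hf'.le j, h⟩
  · exfalso
    have h1 := RootPairing.Base.height_eq_sum h
    have h2 : ∑ j ∈ b.support, f j ≤ 0 := Finset.sum_nonpos fun j _ => hf'.le j
    rw [RootPairing.Base.isPos_iff] at hi
    omega

theorem root_mem_closure_of_isPos {i : ι} (hi : b.IsPos i) :
    P.root i ∈ AddSubmonoid.closure (P.root '' b.support) := by
  obtain ⟨f, hf, h⟩ := exists_root_eq_sum_nonneg hi
  rw [h]
  refine sum_mem fun j hj => ?_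
  obtain ⟨n, hn⟩ := Int.eq_ofNat_of_zero_le (hf j)
  rw [hn, natCast_zsmul]
  exact nsmul_mem (AddSubmonoid.subset_closure (Set.mem_image_of_mem _ hj)) _

theorem exists_sum_of_mem_closure {v : V}
    (hv : v ∈ AddSubmonoid.closure (P.root '' b.support)) :
    ∃ f : ι → ℤ, (∀ j, 0 ≤ f j) ∧ v = ∑ j ∈ b.support, f j • P.root j := by
  classical
  induction hv using AddSubmonoid.closure_induction with
  | mem x hx =>
    obtain ⟨j, hj, rfl⟩ := hx
    refine ⟨Pi.single j 1, fun k => ?_, ?_⟩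
    · by_cases h : k = j
      · subst h; simp
      · simp [h]
    · rw [Finset.sum_eq_single_of_mem j hj fun k _ hk => by simp [hk]]
      simp
  | zero => exact ⟨0, fun _ => le_rfl, by simp⟩
  | add x y _ _ hx hy =>
    obtain ⟨f, hf, rfl⟩ := hx
    obtain ⟨g, hg, rfl⟩ := hy
    exact ⟨f + g, fun j => add_nonneg (hf j) (hg j), by
      simp [add_smul, Finset.sum_add_distrib]⟩

/-- The coefficients of the difference are nonnegative and add up to the difference of the heights,
so equal heights force them all to vanish. Hence a highest root is the only root of maximal height.
-/
theorem height_le_of_sub_mem_closure {i j : ι}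
    (h : P.root j - P.root i ∈ AddSubmonoid.closure (P.root '' b.support)) :
    b.height i ≤ b.height j ∧ (b.height i = b.height j → i = j) := by
  obtain ⟨f, hf, h⟩ := exists_sum_of_mem_closure h
  obtain ⟨g, -, -, hg⟩ := b.exists_root_eq_sum_int i
  have hj : P.root j = ∑ k ∈ b.support, (g + f) k • P.root k := by
    simp only [Pi.add_apply, add_smul, Finset.sum_add_distrib]
    rw [← hg, ← h]
    abel
  rw [RootPairing.Base.height_eq_sum hj, RootPairing.Base.height_eq_sum hg]
  simp only [Pi.add_apply, Finset.sum_add_distrib]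
  have h0 : 0 ≤ ∑ k ∈ b.support, f k := Finset.sum_nonneg fun k _ => hf k
  refine ⟨by omega, fun he => ?_⟩
  have h1 : ∑ k ∈ b.support, f k = 0 := by omega
  have h2 := (Finset.sum_eq_zero_iff_of_nonneg fun k _ => hf k).1 h1
  rw [Finset.sum_eq_zero fun k hk => by rw [h2 k hk, zero_smul]] at h
  exact P.root.injective (sub_eq_zero.1 h).symm

theorem IsHighest.height_le {θ : ι} (hθ : IsHighest b θ) (i : ι) : b.height i ≤ b.height θ :=
  (height_le_of_sub_mem_closure (hθ i)).1

theorem IsHighest.eq_of_height {θ : ι} (hθ : IsHighest b θ) {i : ι}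
    (h : b.height θ ≤ b.height i) : i = θ :=
  (height_le_of_sub_mem_closure (hθ i)).2 (le_antisymm (hθ.height_le i) h)

variable [P.IsCrystallographic]

theorem pairingIn_eq_sum {i : ι} {f : ι → ℤ} (h : P.root i = ∑ j ∈ b.support, f j • P.root j)
    (k : ι) : P.pairingIn ℤ i k = ∑ j ∈ b.support, f j * P.pairingIn ℤ j k := by
  have : ((P.pairingIn ℤ i k : ℤ) : ℚ) =
      ((∑ j ∈ b.support, f j * P.pairingIn ℤ j k : ℤ) : ℚ) := by
    push_cast
    have e : ∀ i k, ((P.pairingIn ℤ i k : ℤ) : ℚ) = P.toLinearMap (P.root i) (P.coroot k) :=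
      fun i k => P.algebraMap_pairingIn ℤ i k
    simp only [e, h, map_sum, map_zsmul, LinearMap.coe_sum, Finset.sum_apply,
      LinearMap.smul_apply, zsmul_eq_mul]
  exact_mod_cast this

theorem height_reflectionPerm (i j : ι) :
    b.height (P.reflectionPerm j i) = b.height i - P.pairingIn ℤ i j * b.height j := by
  have : P.root (P.reflectionPerm j i) = P.root i + (-P.pairingIn ℤ i j) • P.root j := by
    rw [P.root_reflectionPerm, neg_smul, P.reflection_apply_root' ℤ, sub_eq_add_neg]
  rw [b.height_add_zsmul this, smul_eq_mul]
  ring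

theorem isPos_of_height_max {θ : ι} (hθ : ∀ i, b.height i ≤ b.height θ) : b.IsPos θ := by
  rw [RootPairing.Base.isPos_iff]
  have h0 := b.height_ne_zero θ
  have := hθ (P.reflectionPerm θ θ)
  rw [height_reflectionPerm] at this
  simp at this
  omega

/-- Let `p = ⟨i, θ^∨⟩`. The root `-s_θ(i) = pθ - i` is at most as high as `θ`; for `p ≥ 2` this
makes `i` at least as high as `θ`, so `i = θ`. Applying `P.reflectionPerm k` to `k` itself negates
the root of `k`. -/
theorem IsHighest.pairingIn_le_one {θ i : ι} (hθ : IsHighest b θ) (hi : i ≠ θ) :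
    P.pairingIn ℤ i θ ≤ 1 := by
  by_contra! h
  have hpos := isPos_of_height_max hθ.height_le
  rw [RootPairing.Base.isPos_iff] at hpos
  have h1 := hθ.height_le (P.reflectionPerm (P.reflectionPerm θ i) (P.reflectionPerm θ i))
  rw [height_reflectionPerm, height_reflectionPerm, P.pairingIn_same] at h1
  refine hi (hθ.eq_of_height ?_)
  nlinarith

variable [Finite ι]

theorem pairingIn_nonneg_comm {i j : ι} : 0 ≤ P.pairingIn ℤ i j ↔ 0 ≤ P.pairingIn ℤ j i := by
  rw [← not_lt, ← not_lt, not_iff_not]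
  exact P.pairingIn_lt_zero_iff ℤ

/-- A negative pairing would make `θ + α_j` a root higher than `θ`. -/
theorem pairingIn_nonneg_of_height_max {θ : ι} (hθ : ∀ i, b.height i ≤ b.height θ) {j : ι}
    (hj : j ∈ b.support) : 0 ≤ P.pairingIn ℤ θ j := by
  by_contra! h
  have h1 := RootPairing.Base.height_one_of_mem_support hj
  obtain ⟨k, hk⟩ := P.root_add_root_mem_of_pairingIn_neg h fun h' => by
    have := hθ j
    have h2 : θ = P.reflectionPerm j j := P.root.injective (by simpa using h')
    rw [h2, height_reflectionPerm] at this
    simp [h1] at this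
  have := b.height_add hk
  have := hθ k
  omega

theorem pairingIn_nonneg_of_isPos {θ i : ι} (hθ : ∀ i, b.height i ≤ b.height θ)
    (hi : b.IsPos i) : 0 ≤ P.pairingIn ℤ i θ := by
  obtain ⟨f, hf, h⟩ := exists_root_eq_sum_nonneg hi
  rw [pairingIn_eq_sum h]
  exact Finset.sum_nonneg fun j hj => mul_nonneg (hf j)
    (pairingIn_nonneg_comm.1 (pairingIn_nonneg_of_height_max hθ hj))

/-- Let `K` be the set of simple roots occurring in `θ`. For a simple root outside `K`, its pairing
with the dominant `θ` is a sum of nonpositive terms, so it is orthogonal to `K`. The span of `K` is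
then stable under all simple reflections, hence is everything by irreducibility, and linear
independence puts every simple root into `K`. -/
theorem coeff_pos_of_height_max [P.IsReduced] [P.IsIrreducible] {θ : ι}
    (hθ : ∀ i, b.height i ≤ b.height θ) {f : ι → ℤ} (hf : ∀ j, 0 ≤ f j)
    (h : P.root θ = ∑ j ∈ b.support, f j • P.root j) {j : ι} (hj : j ∈ b.support) : 0 < f j := by
  by_contra! hfj
  have hfj : f j = 0 := le_antisymm hfj (hf j)
  let K : Set ι := {k | k ∈ b.support ∧ f k ≠ 0}
  let q : Submodule ℚ V := Submodule.span ℚ (P.root '' K)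
  have hKs : K ⊆ (b.support : Set ι) := fun k hk => hk.1
  have horth : ∀ i ∈ b.support, f i = 0 → ∀ k ∈ K, P.pairingIn ℤ k i = 0 := by
    intro i hi hfi k hk
    have h1 := pairingIn_nonneg_of_height_max hθ hi
    rw [pairingIn_eq_sum h] at h1
    have h2 : ∀ m ∈ b.support, f m * P.pairingIn ℤ m i ≤ 0 := by
      intro m hm
      by_cases hmi : m = i
      · subst hmi; simp [hfi]
      · exact mul_nonpos_of_nonneg_of_nonpos (hf m) (b.pairingIn_le_zero_of_ne hmi hm hi)
    have h3 := (Finset.sum_eq_zero_iff_of_nonpos h2).1 (le_antisymm (Finset.sum_nonpos h2) h1) k hk.1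
    exact (mul_eq_zero.1 h3).resolve_left hk.2
  have hq : ∀ i, q ∈ Module.End.invtSubmodule (P.reflection i) := by
    rw [← b.forall_mem_support_invtSubmodule_iff]
    intro i hi
    rw [Module.End.mem_invtSubmodule]
    refine Submodule.span_le.2 ?_
    rintro _ ⟨k, hk, rfl⟩
    change P.reflection i (P.root k) ∈ q
    rw [P.reflection_apply_root' ℤ]
    refine sub_mem (Submodule.subset_span (Set.mem_image_of_mem _ hk)) ?_
    by_cases hfi : f i = 0
    · rw [horth i hi hfi k hk, zero_smul]
      exact zero_mem _
    · exact zsmul_mem (Submodule.subset_span (Set.mem_image_of_mem _ (show i ∈ K from ⟨hi, hfi⟩))) _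
  have hq0 : q ≠ ⊥ := by
    intro hq0
    have : P.root θ ∈ q := by
      rw [h]
      refine sum_mem fun k hk => ?_
      by_cases hfk : f k = 0
      · rw [hfk, zero_smul]; exact zero_mem _
      · exact zsmul_mem (Submodule.subset_span (Set.mem_image_of_mem _ (show k ∈ K from ⟨hk, hfk⟩))) _
    rw [hq0, Submodule.mem_bot] at this
    exact P.ne_zero θ this
  have htop := RootPairing.IsIrreducible.eq_top_of_invtSubmodule_reflection q hq hq0
  have hmem : P.root j ∈ q := htop ▸ Submodule.mem_top
  have hmemK := (b.linearIndepOn_root.mono hKs).mem_span_iff.1 hmem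
    (b.linearIndepOn_root.mono (Set.insert_subset hj hKs))
  exact hmemK.2 hfj

/-- A root of maximal height works: from any root one climbs towards it by adding simple roots until
the root is dominant, and a dominant root differs from it by zero or a positive root. -/
theorem exists_isHighest [P.IsReduced] [P.IsIrreducible] [Nonempty ι] : ∃ θ, IsHighest b θ := by
  obtain ⟨θ, hθ⟩ := Finite.exists_max b.height
  refine ⟨θ, ?_⟩
  have hpos := isPos_of_height_max hθ
  have key : ∀ (n : ℕ) (i : ι), b.height θ - b.height i < n →
      P.root θ - P.root i ∈ AddSubmonoid.closure (P.root '' b.support) := by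
    intro n
    induction n with
    | zero => intro i hi; have := hθ i; push_cast at hi; omega
    | succ n ih =>
      intro i hi
      by_cases hdom : ∃ j ∈ b.support, P.pairingIn ℤ i j < 0
      · obtain ⟨j, hj, hij⟩ := hdom
        have hmem := AddSubmonoid.subset_closure (Set.mem_image_of_mem P.root hj)
        by_cases h : P.root i = -P.root j
        · rw [h, sub_neg_eq_add]
          exact add_mem (root_mem_closure_of_isPos hpos) hmem
        · obtain ⟨k, hk⟩ := P.root_add_root_mem_of_pairingIn_neg hij h
          have h1 := b.height_add hk
          rw [RootPairing.Base.height_one_of_mem_support hj] at h1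
          have h2 := add_mem (ih k (by push_cast at hi; omega)) hmem
          rwa [hk, sub_add_eq_sub_sub, sub_add_cancel] at h2
      -- The root `i` is now dominant. All coefficients of `θ` are positive and some simple root
      -- pairs nontrivially with `i`, so `⟨θ, i^∨⟩ > 0` and `θ - i` is zero or a root; maximality of
      -- the height of `θ` makes that root positive.
      · push Not at hdom
        obtain ⟨f, hf, h⟩ := exists_root_eq_sum_nonneg hpos
        obtain ⟨j, hj, hji⟩ := b.exists_mem_support_pos_pairingIn_ne_zero i
        have hnn : ∀ j ∈ b.support, 0 ≤ P.pairingIn ℤ j i := fun j hj =>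
          pairingIn_nonneg_comm.1 (hdom j hj)
        have hpair : 0 < P.pairingIn ℤ θ i := by
          rw [pairingIn_eq_sum h]
          exact Finset.sum_pos' (fun k hk => mul_nonneg (hf k) (hnn k hk))
            ⟨j, hj, mul_pos (coeff_pos_of_height_max hθ hf h hj)
              (lt_of_le_of_ne (hnn j hj) (Ne.symm hji))⟩
        by_cases hi : θ = i
        · subst hi
          rw [sub_self]
          exact zero_mem _
        · obtain ⟨k, hk⟩ := P.root_sub_root_mem_of_pairingIn_pos hpair hi
          have h1 := b.height_sub hk
          rw [← hk]
          refine root_mem_closure_of_isPos ?_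
          rw [RootPairing.Base.isPos_iff']
          have := hθ i
          omega
  exact fun i => key ((b.height θ - b.height i).toNat + 1) i (by omega)

end HighestRoot

/-! ### Affine roots, generation by simple reflections, length and exchange. -/

section AffineRoots

variable {ι V N : Type u} [AddCommGroup V] [Module ℚ V] [AddCommGroup N] [Module ℚ N]
  (P : RootPairing ι ℚ V N)

theorem affineRoot_injective : Function.Injective (affineRoot P) := by
  rintro ⟨i, m⟩ ⟨j, n⟩ h
  simp only [affineRoot, Prod.mk.injEq, Int.cast_inj] at h
  exact Prod.ext (P.root.injective h.1) h.2

variable [P.IsCrystallographic]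

/-- The image of the affine root `γ` under the reflection in the affine root `δ`. -/
def reflRoot (δ γ : ι × ℤ) : ι × ℤ :=
  (P.reflectionPerm δ.1 γ.1, γ.2 - P.pairingIn ℤ γ.1 δ.1 * δ.2)

theorem coe_pairingIn (i j : ι) :
    ((P.pairingIn ℤ i j : ℤ) : ℚ) = P.toLinearMap (P.root i) (P.coroot j) :=
  P.algebraMap_pairingIn ℤ i j

theorem affineAct_affineRoot (δ γ : ι × ℤ) :
    affineAct P (affineReflection P δ) (affineRoot P γ) = affineRoot P (reflRoot P δ γ) := by
  rw [affineAct_reflection]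
  refine Prod.ext ?_ ?_
  · simp only [affineRoot, reflRoot, Prod.fst_sub, Prod.smul_fst, P.root_reflectionPerm,
      P.reflection_apply]
    rfl
  · simp only [affineRoot, reflRoot, Prod.snd_sub, Prod.smul_snd, smul_eq_mul]
    push_cast
    rw [coe_pairingIn]

theorem refl_reflRoot (δ γ : ι × ℤ) :
    refl P (reflRoot P δ γ) = refl P δ * refl P γ * refl P δ := by
  refine Subtype.ext (AffineEquiv.ext fun v => ?_)
  change affineReflection P (reflRoot P δ γ) v =
    affineReflection P δ (affineReflection P γ (affineReflection P δ v))
  have h1 : ∀ c : ℚ, ∀ u w : N, affineReflection P δ (u - c • w) =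
      affineReflection P δ u - c • P.coreflection δ.1 w := by
    intro c u w
    simp only [affineReflection_apply, P.coreflection_apply, map_sub, map_smul, smul_sub,
      sub_smul, add_smul, smul_eq_mul, smul_smul]
    change _ = _ - (_ - (c * P.toLinearMap (P.root δ.1) w) • _)
    module
  have h2 := affineAct_spec P (affineReflection P δ) (affineRoot P γ) v
  rw [affineAct_affineRoot, affineReflection_inv] at h2
  rw [affineReflection_apply P γ, h1, affineReflection_apply P (reflRoot P δ γ)]
  have h3 : affineReflection P δ (affineReflection P δ v) = v :=
    congrArg (fun f : N ≃ᵃ[ℚ] N => f v) (affineReflection_mul_self P δ)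
  rw [h3]
  change v - (P.toLinearMap (affineRoot P _).1 v + (affineRoot P _).2) • _ = _
  rw [h2]
  simp only [reflRoot, P.coroot_reflectionPerm]
  rfl

/-- The index `reflRoot P γ γ` serves throughout as the negative of `γ`. -/
theorem reflRoot_self (γ : ι × ℤ) : affineRoot P (reflRoot P γ γ) = -affineRoot P γ := by
  refine Prod.ext ?_ ?_
  · simp [affineRoot, reflRoot]
  · simp only [affineRoot, reflRoot, P.pairingIn_same, Prod.snd_neg]
    push_cast
    ring

theorem refl_reflRoot_self (γ : ι × ℤ) : refl P (reflRoot P γ γ) = refl P γ := by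
  rw [refl_reflRoot, refl_mul_self, one_mul]

/-- The generating reflections permute the affine roots, hence so does the group. Since `affineRoot`
is injective, the index is unique, and choosing it yields an action. -/
theorem exists_rootAct (w : affineWeylGroup P) (γ : ι × ℤ) :
    ∃ δ, affineRoot P δ = affineAct P w (affineRoot P γ) ∧ refl P δ = w * refl P γ * w⁻¹ := by
  obtain ⟨w, hw⟩ := w
  have key : ∀ δ γ, affineRoot P (reflRoot P δ γ) = affineAct P (refl P δ) (affineRoot P γ) ∧
      refl P (reflRoot P δ γ) = refl P δ * refl P γ * (refl P δ)⁻¹ := fun δ γ =>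
    ⟨(affineAct_affineRoot P δ γ).symm, by
      rw [refl_reflRoot, eq_mul_inv_iff_mul_eq, mul_assoc, refl_mul_self, mul_one]⟩
  induction hw using Subgroup.closure_induction'' generalizing γ with
  | one => exact ⟨γ, (affineAct_one P _).symm, by
      change refl P γ = 1 * refl P γ * 1⁻¹
      group⟩
  | mem x hx => obtain ⟨δ, rfl⟩ := hx; exact ⟨_, key δ γ⟩
  | inv_mem x hx =>
    obtain ⟨δ, rfl⟩ := hx
    refine ⟨reflRoot P δ γ, ?_⟩
    · simp only [affineReflection_inv]
      exact key δ γ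
  | mul x y hx hy ihx ihy =>
    obtain ⟨δ, h1, h2⟩ := ihy γ
    obtain ⟨ε, h3, h4⟩ := ihx δ
    refine ⟨ε, ?_, ?_⟩
    · change _ = affineAct P (x * y) _
      rw [affineAct_mul, h3, h1]
    · rw [h4, h2]
      change _ = ((⟨x, hx⟩ : affineWeylGroup P) * ⟨y, hy⟩) * refl P γ *
        ((⟨x, hx⟩ : affineWeylGroup P) * ⟨y, hy⟩)⁻¹
      group

/-- The action of the affine Weyl group on (the indices of) affine roots. -/
def rootAct (w : affineWeylGroup P) (γ : ι × ℤ) : ι × ℤ := (exists_rootAct P w γ).choose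

theorem affineRoot_rootAct (w : affineWeylGroup P) (γ : ι × ℤ) :
    affineRoot P (rootAct P w γ) = affineAct P w (affineRoot P γ) :=
  (exists_rootAct P w γ).choose_spec.1

theorem refl_rootAct (w : affineWeylGroup P) (γ : ι × ℤ) :
    refl P (rootAct P w γ) = w * refl P γ * w⁻¹ :=
  (exists_rootAct P w γ).choose_spec.2

theorem rootAct_mul (v w : affineWeylGroup P) (γ : ι × ℤ) :
    rootAct P (v * w) γ = rootAct P v (rootAct P w γ) :=
  affineRoot_injective P (by
    rw [affineRoot_rootAct, affineRoot_rootAct, affineRoot_rootAct, Subgroup.coe_mul,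
      affineAct_mul])

theorem rootAct_one (γ : ι × ℤ) : rootAct P 1 γ = γ :=
  affineRoot_injective P (by rw [affineRoot_rootAct, Subgroup.coe_one, affineAct_one])

theorem rootAct_refl (δ γ : ι × ℤ) : rootAct P (refl P δ) γ = reflRoot P δ γ :=
  affineRoot_injective P (by rw [affineRoot_rootAct, ← affineAct_affineRoot]; rfl)

theorem affineAct_neg (g : N ≃ᵃ[ℚ] N) (ν : V × ℚ) :
    affineAct P g (-ν) = -affineAct P g ν :=
  affineFun_ext P fun v => by
    have h1 := affineAct_spec P g (-ν) v
    have h2 := affineAct_spec P g ν v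
    simp only [Prod.fst_neg, Prod.snd_neg, map_neg, LinearMap.neg_apply] at h1 ⊢
    linarith

theorem rootAct_reflRoot_self (w : affineWeylGroup P) (γ : ι × ℤ) :
    rootAct P w (reflRoot P γ γ) = reflRoot P (rootAct P w γ) (rootAct P w γ) :=
  affineRoot_injective P (by
    rw [affineRoot_rootAct, reflRoot_self, reflRoot_self, affineRoot_rootAct, affineAct_neg])

variable {P} (b : P.Base)

theorem isPositive_reflRoot_self (γ : ι × ℤ) :
    IsPositive b (reflRoot P γ γ) ↔ ¬IsPositive b γ := by
  obtain ⟨i, n⟩ := γ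
  have h := b.height_ne_zero i
  simp only [IsPositive, reflRoot, P.pairingIn_same, RootPairing.Base.isPos_iff,
    height_reflectionPerm]
  omega

theorem IsSimple.isPositive [Finite ι] {γ : ι × ℤ} (h : IsSimple b γ) : IsPositive b γ := by
  rcases h with ⟨h1, h2⟩ | ⟨h1, -⟩
  · exact Or.inr ⟨h1, RootPairing.Base.isPos_of_mem_support h2⟩
  · exact Or.inl (by omega)

variable [Finite ι] [P.IsReduced]

/-- For `α = (-θ, 1)` the level `n` becomes `n + ⟨i, θ^∨⟩`. The pairing is at least `-1` unless `i =
-θ`, and nonnegative for positive `i`, so only the cases `i = -θ` and pairing `-1` can lower the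
level. -/
theorem IsSimple.isPositive_reflRoot {α γ : ι × ℤ} (hα : IsSimple b α) (hγ : IsPositive b γ)
    (hne : γ ≠ α) : IsPositive b (reflRoot P α γ) := by
  obtain ⟨i, n⟩ := γ
  obtain ⟨a, k⟩ := α
  rcases hα with ⟨h1, h2⟩ | ⟨h1, θ, hθ, h2⟩
  · simp only at h1 h2
    subst h1
    simp only [IsPositive, reflRoot, mul_zero, sub_zero] at hγ ⊢
    refine hγ.imp_right fun h => ⟨h.1, h.2.reflectionPerm h2 fun h' => hne ?_⟩
    rw [h', h.1]
  · simp only at h1 h2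
    subst h1
    have ha : a = P.reflectionPerm θ θ := P.root.injective (by simpa using h2)
    have hθ0 := isPos_of_height_max hθ.height_le
    have hc : P.pairingIn ℤ i a = -P.pairingIn ℤ i θ := by
      rw [ha, P.pairingIn_reflectionPerm_self_right]
    have hha : b.height a = -b.height θ := by
      rw [ha, height_reflectionPerm, P.pairingIn_same]
      ring
    have hhi : b.height (P.reflectionPerm i i) = -b.height i := by
      rw [height_reflectionPerm, P.pairingIn_same]
      ring
    have hle := hθ.height_le (P.reflectionPerm i i)
    simp only [IsPositive, reflRoot, RootPairing.Base.isPos_iff, height_reflectionPerm, hc, hha]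
      at hγ hθ0 ⊢
    by_cases hi : i = θ
    · subst hi
      rw [P.pairingIn_same]
      omega
    by_cases hi' : P.reflectionPerm i i = θ
    · have hia : i = a := by
        refine P.root.injective ?_
        rw [h2, ← hi']
        simp
      have hn : n ≠ 1 := fun hn => hne (by rw [hn, hia])
      have h6 : P.pairingIn ℤ i θ = -2 := by
        rw [← hi', P.pairingIn_reflectionPerm_self_right, P.pairingIn_same]
      rw [h6]
      rw [hia] at hγ ⊢
      omega
    · have h4 := hθ.pairingIn_le_one hi'
      rw [P.pairingIn_reflectionPerm_self_left] at h4
      have h5 : b.IsPos i → 0 ≤ P.pairingIn ℤ i θ := pairingIn_nonneg_of_isPos hθ.height_le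
      rw [RootPairing.Base.isPos_iff] at h5
      have h6 : b.height (P.reflectionPerm i i) ≠ b.height θ := fun h =>
        hi' (hθ.eq_of_height h.ge)
      rcases lt_trichotomy (P.pairingIn ℤ i θ) 0 with h | h | h
      -- Here `i` is not positive, so `n ≥ 1`. If the level drops to `0`, the new finite root has
      -- height `ht i + ht θ`, which is positive because `-i` is strictly lower than `θ`.
      · have h7 : P.pairingIn ℤ i θ = -1 := by omega
        rw [h7]
        omega
      · rw [h]
        omega
      · left
        omega

/-- The expression `ht α + n (ht θ + 1)` is the affine height: it equals `1` on every simple affine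
root. It is the induction measure for generation by simple reflections. -/
theorem affineHeight_pos {θ : ι} (hθ : IsHighest b θ) {γ : ι × ℤ} (hγ : IsPositive b γ) :
    0 < b.height γ.1 + γ.2 * (b.height θ + 1) := by
  have hle := hθ.height_le (P.reflectionPerm γ.1 γ.1)
  rw [height_reflectionPerm, P.pairingIn_same] at hle
  have hθ0 := isPos_of_height_max hθ.height_le
  simp only [IsPositive, RootPairing.Base.isPos_iff] at hγ hθ0
  rcases hγ with h | ⟨h, h'⟩
  · nlinarith
  · rw [h]
    omega

/-- Every affine root has a positive pairing with some simple affine root. -/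
theorem exists_isSimple_pairingIn_pos {θ : ι} (hθ : IsHighest b θ) (γ : ι × ℤ) :
    ∃ α, IsSimple b α ∧ 0 < P.pairingIn ℤ γ.1 α.1 := by
  by_contra! h
  have h1 : ∀ j ∈ b.support, P.pairingIn ℤ γ.1 j ≤ 0 := fun j hj => h (j, 0) (Or.inl ⟨rfl, hj⟩)
  have h2 := h (P.reflectionPerm θ θ, 1) (Or.inr ⟨rfl, θ, hθ, by simp⟩)
  simp only [P.pairingIn_reflectionPerm_self_right] at h2
  have h4 : 0 ≤ P.pairingIn ℤ θ γ.1 := pairingIn_nonneg_comm.1 (by omega)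
  -- `θ + γ` is a nonnegative combination of simple roots, hence pairs nonpositively with `γ^∨`; but
  -- that pairing is `⟨θ, γ^∨⟩ + 2 ≥ 2`.
  obtain ⟨f, hf, hs⟩ := exists_sum_of_mem_closure (hθ (P.reflectionPerm γ.1 γ.1))
  have h5 := congrArg (fun v => P.toLinearMap v (P.coroot γ.1)) hs
  simp only [map_sub, map_sum, map_zsmul, LinearMap.coe_sum, Finset.sum_apply,
    LinearMap.smul_apply, LinearMap.sub_apply, ← coe_pairingIn, zsmul_eq_mul] at h5
  have h6 : P.pairingIn ℤ θ γ.1 - P.pairingIn ℤ (P.reflectionPerm γ.1 γ.1) γ.1 =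
      ∑ j ∈ b.support, f j * P.pairingIn ℤ j γ.1 := by exact_mod_cast h5
  have h7 : ∑ j ∈ b.support, f j * P.pairingIn ℤ j γ.1 ≤ 0 := Finset.sum_nonpos fun j hj =>
    mul_nonpos_of_nonneg_of_nonpos (hf j) ((P.pairingIn_le_zero_iff ℤ).1 (h1 j hj))
  rw [P.pairingIn_reflectionPerm_self_left, P.pairingIn_same] at h6
  omega

theorem affineHeight_reflRoot_lt {θ : ι} (hθ : IsHighest b θ) {α γ : ι × ℤ}
    (hα : IsSimple b α) (h : 0 < P.pairingIn ℤ γ.1 α.1) :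
    b.height (reflRoot P α γ).1 + (reflRoot P α γ).2 * (b.height θ + 1) <
      b.height γ.1 + γ.2 * (b.height θ + 1) := by
  have h1 : 0 < b.height α.1 + α.2 * (b.height θ + 1) := affineHeight_pos b hθ hα.isPositive
  simp only [reflRoot, height_reflectionPerm]
  nlinarith

/-- Induction on the affine height: some simple `α` pairs positively with `γ`, so `s_α(γ)` is lower
and, unless `γ = α`, still positive. Conjugating its reflection by `s_α` gives that of `γ`. -/
theorem refl_mem_closure [P.IsIrreducible] (γ : ι × ℤ) :
    refl P γ ∈ Subgroup.closure (simpleReflections b) := by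
  have : Nonempty ι := ⟨γ.1⟩
  obtain ⟨θ, hθ⟩ := exists_isHighest (b := b)
  have key : ∀ (n : ℕ) (γ : ι × ℤ), IsPositive b γ →
      b.height γ.1 + γ.2 * (b.height θ + 1) ≤ n →
      refl P γ ∈ Subgroup.closure (simpleReflections b) := by
    intro n
    induction n with
    | zero => intro γ hγ h; have := affineHeight_pos b hθ hγ; push_cast at h; omega
    | succ n ih =>
      intro γ hγ h
      obtain ⟨α, hα, hp⟩ := exists_isSimple_pairingIn_pos b hθ γ
      have hαm : refl P α ∈ Subgroup.closure (simpleReflections b) :=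
        Subgroup.subset_closure ⟨α, hα, rfl⟩
      by_cases hne : γ = α
      · rwa [hne]
      have h1 := affineHeight_reflRoot_lt b hθ hα hp
      have h2 := ih _ (hα.isPositive_reflRoot b hγ hne) (by push_cast at h; omega)
      rw [refl_reflRoot] at h2
      have h3 := mul_mem (mul_mem hαm h2) hαm
      simpa only [mul_assoc, refl_mul_self, mul_one, ← mul_assoc (refl P α) (refl P α) _,
        one_mul] using h3
  by_cases hγ : IsPositive b γ
  · exact key _ γ hγ (Int.self_le_toNat _)
  · rw [← refl_reflRoot_self]
    exact key _ _ ((isPositive_reflRoot_self b γ).2 hγ) (Int.self_le_toNat _)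

theorem closure_simpleReflections [P.IsIrreducible] :
    Subgroup.closure (simpleReflections b) = ⊤ := by
  refine top_unique fun ⟨w, hw⟩ _ => ?_
  induction hw using Subgroup.closure_induction with
  | mem x hx => obtain ⟨γ, rfl⟩ := hx; exact refl_mem_closure b γ
  | one => exact one_mem _
  | mul x y hx hy ihx ihy => exact mul_mem (ihx trivial) (ihy trivial)
  | inv x hx ih => exact inv_mem (ih trivial)

theorem exists_list_length [P.IsIrreducible] (w : affineWeylGroup P) :
    ∃ L : List (affineWeylGroup P),
      (∀ s ∈ L, s ∈ simpleReflections b) ∧ L.prod = w ∧ L.length = length b w := by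
  have hw : w ∈ Subgroup.closure (simpleReflections b) := by
    rw [closure_simpleReflections]; trivial
  rw [← Subgroup.mem_toSubmonoid, Subgroup.closure_toSubmonoid] at hw
  obtain ⟨L, hL, hp⟩ := Submonoid.exists_list_of_mem_closure hw
  have : {n | ∃ L : List (affineWeylGroup P),
      (∀ s ∈ L, s ∈ simpleReflections b) ∧ L.prod = w ∧ L.length = n}.Nonempty := by
    refine ⟨L.length, L, fun s hs => (hL s hs).elim id fun h => ?_, hp, rfl⟩
    have h1 : s⁻¹ * s⁻¹ = 1 := simple_mul_self b ⟨_, h⟩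
    have h2 := inv_eq_of_mul_eq_one_left h1
    rw [inv_inv] at h2
    rwa [h2]
  exact Nat.sInf_mem this

theorem length_prod_le (L : List (affineWeylGroup P)) (hL : ∀ s ∈ L, s ∈ simpleReflections b) :
    length b L.prod ≤ L.length :=
  Nat.sInf_le ⟨L, hL, rfl, rfl⟩

/-- The exchange condition. -/
theorem exists_refl_mul_prod_eq (L : List (affineWeylGroup P))
    (hL : ∀ s ∈ L, s ∈ simpleReflections b) (β : ι × ℤ) (hβ : IsPositive b β)
    (h : ¬IsPositive b (rootAct P L.prod⁻¹ β)) :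
    ∃ L' : List (affineWeylGroup P), (∀ s ∈ L', s ∈ simpleReflections b) ∧
      refl P β * L.prod = L'.prod ∧ L'.length < L.length := by
  induction L generalizing β with
  | nil => simp [rootAct_one, hβ] at h
  | cons s L ih =>
    obtain ⟨α, hα, rfl⟩ := hL s List.mem_cons_self
    have hL' : ∀ s ∈ L, s ∈ simpleReflections b := fun s hs => hL s (List.mem_cons_of_mem _ hs)
    -- The first letter makes no positive root negative except its own. Either `β` is that root and
    -- the letter is deleted, or `s_α(β)` is still positive and the exchange takes place in the
    -- tail.
    by_cases hne : β = α
    · subst hne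
      exact ⟨L, hL', by rw [List.prod_cons, ← mul_assoc, refl_mul_self, one_mul], by simp⟩
    · have hinv : (refl P α)⁻¹ = refl P α := inv_eq_of_mul_eq_one_left (refl_mul_self P α)
      rw [List.prod_cons, mul_inv_rev, rootAct_mul, hinv, rootAct_refl] at h
      obtain ⟨L', h1, h2, h3⟩ := ih hL' _ (hα.isPositive_reflRoot b hβ hne) h
      refine ⟨refl P α :: L', ?_, ?_, by simpa using h3⟩
      · rintro s (_ | ⟨_, hs⟩)
        · exact ⟨α, hα, rfl⟩
        · exact h1 s hs
      · rw [List.prod_cons, List.prod_cons, ← h2, refl_reflRoot]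
        simp only [← mul_assoc, refl_mul_self, one_mul]

variable [P.IsIrreducible]

theorem length_refl_mul_lt {β : ι × ℤ} (hβ : IsPositive b β) {w : affineWeylGroup P}
    (h : ¬IsPositive b (rootAct P w⁻¹ β)) : length b (refl P β * w) < length b w := by
  obtain ⟨L, hL, rfl, hlen⟩ := exists_list_length b w
  obtain ⟨L', h1, h2, h3⟩ := exists_refl_mul_prod_eq b L hL β hβ h
  rw [h2, ← hlen]
  exact (length_prod_le b L' h1).trans_lt h3

/-- This is the previous lemma for `s_β w`, whose inverse sends `β` to `-w⁻¹(β)`. -/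
theorem lt_length_refl_mul {β : ι × ℤ} (hβ : IsPositive b β) {w : affineWeylGroup P}
    (h : IsPositive b (rootAct P w⁻¹ β)) : length b w < length b (refl P β * w) := by
  have := length_refl_mul_lt b hβ (w := refl P β * w) (by
    have hinv : (refl P β)⁻¹ = refl P β := inv_eq_of_mul_eq_one_left (refl_mul_self P β)
    have h1 : rootAct P (refl P β) β = reflRoot P β β := rootAct_refl P β β
    rw [mul_inv_rev, rootAct_mul, hinv, h1, rootAct_reflRoot_self, isPositive_reflRoot_self,
      not_not]
    exact h)
  rwa [← mul_assoc, refl_mul_self, one_mul] at this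

theorem BruhatLT.length_lt {x y : affineWeylGroup P} (h : BruhatLT b x y) :
    length b x < length b y := by
  induction h with
  | single h => exact h.choose_spec.2
  | tail _ h ih => exact ih.trans h.choose_spec.2

theorem length_one : length b (1 : affineWeylGroup P) = 0 :=
  Nat.le_zero.1 (length_prod_le b [] (by simp))

end AffineRoots

/-! ### Linear forms in the symmetric algebra. -/

section SymmetricAlgebra

variable {F : Type u} [Field F] {W : Type u} [AddCommGroup W] [Module F W]

/-- Completing `w` to a basis turns it into a variable of a polynomial ring. -/
theorem prime_ι {w : W} (hw : w ≠ 0) : Prime (SymmetricAlgebra.ι F W w) := by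
  classical
  have hli : LinearIndepOn F id ({w} : Set W) := LinearIndepOn.singleton hw
  let B := Module.Basis.extend hli
  let i : hli.extend (Set.subset_univ _) :=
    ⟨w, hli.subset_extend (Set.subset_univ _) rfl⟩
  have hB : B i = w := Module.Basis.extend_apply_self hli i
  have := MvPolynomial.X_prime (R := F) (i := i)
  rw [← hB, ← MulEquiv.prime_iff (SymmetricAlgebra.equivMvPolynomial B).toMulEquiv]
  convert this
  exact SymmetricAlgebra.equivMvPolynomial_ι_apply B i

/-- Otherwise a linear form vanishes on `v` but not on `w`, and its extension to the symmetric
algebra contradicts divisibility. -/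
theorem exists_smul_eq_of_ι_dvd {v w : W}
    (h : SymmetricAlgebra.ι F W v ∣ SymmetricAlgebra.ι F W w) : ∃ c : F, w = c • v := by
  by_contra hne
  have hmem : w ∉ Submodule.span F {v} := fun hm => by
    obtain ⟨c, hc⟩ := Submodule.mem_span_singleton.1 hm
    exact hne ⟨c, hc.symm⟩
  obtain ⟨f, hf, hf0⟩ := Submodule.exists_le_ker_of_notMem hmem
  obtain ⟨g, hg⟩ := h
  have := congrArg (SymmetricAlgebra.lift f) hg
  rw [map_mul, SymmetricAlgebra.lift_ι_apply, SymmetricAlgebra.lift_ι_apply] at this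
  have hv : f v = 0 := hf0 (Submodule.mem_span_singleton_self v)
  rw [hv, zero_mul] at this
  exact hf this

end SymmetricAlgebra

/-! ### Labels and edges of the affine moment graph; the set `J(s)`. -/

section AffineGraph

variable {ι V N : Type u} [AddCommGroup V] [Module ℚ V] [AddCommGroup N] [Module ℚ N]
  (P : RootPairing ι ℚ V N) (F : Type u) [Field F] [P.IsCrystallographic]

theorem bar_add (μ ν : affineWeights P) : bar P F (μ + ν) = bar P F μ + bar P F ν :=
  TensorProduct.tmul_add _ _ _

theorem bar_zsmul (n : ℤ) (ν : affineWeights P) : bar P F (n • ν) = (n : F) • bar P F ν := by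
  rw [bar, bar, TensorProduct.tmul_smul, Int.cast_smul_eq_zsmul]

theorem bar_neg (ν : affineWeights P) : bar P F (-ν) = -bar P F ν :=
  TensorProduct.tmul_neg _ _

/-- The label of the affine root `γ`. -/
abbrev barRoot (γ : ι × ℤ) : LabelSpace P F := bar P F ⟨affineRoot P γ, affineRoot_mem P γ⟩

/-- Pairing with `γ^∨` is integral on affine weights, so it induces an additive map from the label
space to `F`. Its value on this label is `2`. -/
theorem barRoot_ne_zero (hF : (2 : F) ≠ 0) (γ : ι × ℤ) : barRoot P F γ ≠ 0 := by
  intro h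
  let f : affineWeights P →ₗ[ℤ] ℚ :=
    ((P.toLinearMap.flip (P.coroot γ.1)).restrictScalars ℤ ∘ₗ LinearMap.fst ℤ V ℚ) ∘ₗ
      (affineWeights P).subtype
  have hf : ∀ ν, f ν ∈ LinearMap.range (Algebra.linearMap ℤ ℚ) := fun ν => by
    obtain ⟨n, hn⟩ := ν.2.1 γ.1
    exact ⟨n, hn.symm⟩
  let e : ℤ ≃ₗ[ℤ] LinearMap.range (Algebra.linearMap ℤ ℚ) :=
    LinearEquiv.ofInjective _ Int.cast_injective
  let g : affineWeights P →ₗ[ℤ] ℤ := e.symm.toLinearMap ∘ₗ f.codRestrict _ hf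
  let k : F ⊗[ℤ] affineWeights P →ₗ[ℤ] F :=
    TensorProduct.lift (LinearMap.lsmul ℤ F ∘ₗ g).flip
  have h1 : g ⟨affineRoot P γ, affineRoot_mem P γ⟩ = 2 := by
    change e.symm _ = 2
    rw [LinearEquiv.symm_apply_eq]
    refine Subtype.ext ?_
    change P.toLinearMap (P.root γ.1) (P.coroot γ.1) = ((2 : ℤ) : ℚ)
    rw [P.root_coroot_two]
    norm_num
  have h2 := congrArg k h
  rw [map_zero] at h2
  change g ⟨affineRoot P γ, affineRoot_mem P γ⟩ • (1 : F) = 0 at h2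
  rw [h1, zsmul_eq_mul, mul_one] at h2
  exact hF (by exact_mod_cast h2)

theorem weylAct_mul (v w : affineWeylGroup P) (ν : affineWeights P) :
    weylAct P (v * w) ν = weylAct P v (weylAct P w ν) :=
  Subtype.ext (affineAct_mul P v w ν)

theorem weylAct_one (ν : affineWeights P) : weylAct P 1 ν = ν :=
  Subtype.ext (affineAct_one P ν)

theorem weylAct_affineRoot (w : affineWeylGroup P) (γ : ι × ℤ) :
    weylAct P w ⟨affineRoot P γ, affineRoot_mem P γ⟩ =
      ⟨affineRoot P (rootAct P w γ), affineRoot_mem P _⟩ :=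
  Subtype.ext (affineRoot_rootAct P w γ).symm

/-- A reflection changes an affine weight by an integral multiple of the affine root. -/
theorem exists_bar_weylAct_refl (γ : ι × ℤ) (ν : affineWeights P) :
    ∃ c : F, bar P F (weylAct P (refl P γ) ν) = bar P F ν + c • barRoot P F γ := by
  obtain ⟨n, hn⟩ := ν.2.1 γ.1
  have : weylAct P (refl P γ) ν = ν + (-n) • ⟨affineRoot P γ, affineRoot_mem P γ⟩ := by
    refine Subtype.ext ?_
    change affineAct P (affineReflection P γ) ν = (ν : V × ℚ) + (-n) • affineRoot P γ
    rw [affineAct_reflection, hn, Int.cast_smul_eq_zsmul, neg_smul, sub_eq_add_neg]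
  exact ⟨((-n : ℤ) : F), by rw [this, bar_add, bar_zsmul]⟩

theorem barRoot_reflRoot_self (γ : ι × ℤ) :
    barRoot P F (reflRoot P γ γ) = -barRoot P F γ := by
  rw [← bar_neg]
  exact congrArg (bar P F) (Subtype.ext (reflRoot_self P γ))

variable {P} {b : P.Base}

theorem toCoset_mul (s : simpleReflections b) (x : affineWeylGroup P) :
    toCoset s (x * s) = toCoset s x :=
  QuotientGroup.mk_mul_of_mem x (Subgroup.mem_zpowers _)

theorem mul_simple_mul_simple (s : simpleReflections b) (x : affineWeylGroup P) :
    x * (s : affineWeylGroup P) * s = x := by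
  rw [mul_assoc, simple_mul_self, mul_one]

variable (b) in
/-- The affine weight `x(α)` for the simple affine root `α` of `s`. -/
abbrev twist (s : simpleReflections b) (x : affineWeylGroup P) : affineWeights P :=
  weylAct P x ⟨affineRoot P (simpleRoot b s), affineRoot_mem P _⟩

theorem bar_twist (s : simpleReflections b) (x : affineWeylGroup P) :
    bar P F (twist b s x) = barRoot P F (rootAct P x (simpleRoot b s)) := by
  rw [twist, weylAct_affineRoot]

theorem bar_twist_ne_zero (hF : (2 : F) ≠ 0) (s : simpleReflections b) (x : affineWeylGroup P) :
    bar P F (twist b s x) ≠ 0 := by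
  rw [bar_twist]
  exact barRoot_ne_zero P F hF _

theorem bar_twist_mul (s : simpleReflections b) (x : affineWeylGroup P) :
    bar P F (twist b s (x * s)) = -bar P F (twist b s x) := by
  have h : rootAct P (x * s) (simpleRoot b s) =
      reflRoot P (rootAct P x (simpleRoot b s)) (rootAct P x (simpleRoot b s)) := by
    rw [rootAct_mul, ← rootAct_reflRoot_self]
    conv_lhs => rw [← (simpleRoot_spec b s).2, rootAct_refl]
  rw [bar_twist, bar_twist, h, barRoot_reflRoot_self]

variable [Finite ι] [P.IsReduced] [P.IsIrreducible]

/-- Otherwise the exchange condition would make the target shorter than the source. With `mkEdge`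
this gives the criterion by which edges are recognised and constructed below. -/
theorem AffineEdge.isPositive (e : (affineGraph b F).Edge) :
    IsPositive b (rootAct P e.1.1.1⁻¹ e.1.2) := by
  by_contra h
  have h1 := length_refl_mul_lt b e.2.1 h
  rw [← e.2.2.2] at h1
  exact absurd (BruhatLT.length_lt b e.2.2.1) (by omega)

/-- The edge from `x` to `s_β x` for a positive affine root `β` such that `x⁻¹(β)` is positive. -/
def mkEdge {β : ι × ℤ} (hβ : IsPositive b β) {x : affineWeylGroup P}
    (h : IsPositive b (rootAct P x⁻¹ β)) : (affineGraph b F).Edge :=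
  ⟨((x, refl P β * x), β), hβ, Relation.TransGen.single ⟨β, rfl, lt_length_refl_mul b hβ h⟩, rfl⟩

theorem src_ne_tgt (e : (affineGraph b F).Edge) : e.1.1.1 ≠ e.1.1.2 := fun h => by
  have := BruhatLT.length_lt b e.2.2.1
  rw [h] at this
  exact lt_irrefl _ this

theorem tgt_ne_one (e : (affineGraph b F).Edge) : e.1.1.2 ≠ 1 := fun h => by
  have := BruhatLT.length_lt b e.2.2.1
  rw [h, length_one] at this
  exact Nat.not_lt_zero _ this

/-- There is an edge between `x` and `x s`, with label `±x(α)` for the simple root `α` of `s`. -/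
theorem exists_edge_fibre (s : simpleReflections b) (x : affineWeylGroup P) :
    ∃ e : (affineGraph b F).Edge,
      ((e.1.1.1 = x ∧ e.1.1.2 = x * s) ∨ (e.1.1.1 = x * s ∧ e.1.1.2 = x)) ∧
      (barRoot P F e.1.2 = bar P F (twist b s x) ∨
        barRoot P F e.1.2 = -bar P F (twist b s x)) := by
  set α := simpleRoot b s
  have hα := simpleRoot_spec b s
  obtain ⟨β, hβ, hr, hl⟩ : ∃ β, IsPositive b β ∧ refl P β = x * s * x⁻¹ ∧
      (barRoot P F β = bar P F (twist b s x) ∨ barRoot P F β = -bar P F (twist b s x)) := by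
    rw [bar_twist]
    -- `β` is whichever of `±x(α)` is positive; this is the source of the sign in the label.
    by_cases h : IsPositive b (rootAct P x α)
    · exact ⟨_, h, by rw [refl_rootAct, hα.2], Or.inl rfl⟩
    · exact ⟨_, (isPositive_reflRoot_self b _).2 h, by
        rw [refl_reflRoot_self, refl_rootAct, hα.2], Or.inr (barRoot_reflRoot_self P F _)⟩
  have hx : refl P β * x = x * s := by rw [hr]; group
  by_cases h : IsPositive b (rootAct P x⁻¹ β)
  · exact ⟨mkEdge F hβ h, Or.inl ⟨rfl, hx⟩, hl⟩
  · refine ⟨mkEdge F hβ (x := x * s) ?_, Or.inr ⟨rfl, ?_⟩, hl⟩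
    · have h2 : (refl P β)⁻¹ = refl P β := inv_eq_of_mul_eq_one_left (refl_mul_self P β)
      rw [← hx, mul_inv_rev, rootAct_mul, h2, rootAct_refl, rootAct_reflRoot_self,
        isPositive_reflRoot_self]
      exact h
    · change refl P β * (x * s) = x
      rw [← hx, ← mul_assoc, refl_mul_self, one_mul]

/-- The edge `E s` parallel to an edge `E`. -/
theorem exists_edge_mul (s : simpleReflections b) (e : (affineGraph b F).Edge)
    (he : toCoset s e.1.1.1 ≠ toCoset s e.1.1.2) :
    ∃ e' : (affineGraph b F).Edge, e'.1.1.1 = e.1.1.1 * s ∧ e'.1.1.2 = e.1.1.2 * s ∧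
      e'.1.2 = e.1.2 := by
  have hα := simpleRoot_spec b s
  have hinv : (s : affineWeylGroup P)⁻¹ = s := inv_eq_of_mul_eq_one_left (simple_mul_self b s)
  refine ⟨mkEdge F e.2.1 (x := e.1.1.1 * s) ?_, rfl, ?_, rfl⟩
  · rw [mul_inv_rev, rootAct_mul, hinv]
    conv => arg 2; arg 2; rw [← hα.2]
    rw [rootAct_refl]
    -- The reflection `s` keeps `x⁻¹(β)` positive unless `x⁻¹(β) = α`. In that case `s_β x = x s`,
    -- and the given edge would stay inside one coset.
    refine hα.1.isPositive_reflRoot b (AffineEdge.isPositive F e) fun h => he ?_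
    have h1 : refl P e.1.2 = e.1.1.1 * s * e.1.1.1⁻¹ := by
      rw [← hα.2, ← h, refl_rootAct]
      group
    rw [e.2.2.2, h1, inv_mul_cancel_right, toCoset_mul]
  · change refl P e.1.2 * (e.1.1.1 * s) = _
    rw [← mul_assoc, ← e.2.2.2]

/-- The exchange condition for subsequences. Let `y` be the product without the last entry. If
`y⁻¹(β)` is already negative, the exchange happens in `y`. Otherwise the last entry is kept and
turns `y⁻¹(β)` negative, so `y⁻¹(β)` is its simple root and `s_β` cancels that entry. -/
theorem refl_mul_ev_mem {l : ℕ} (s : Fin l → simpleReflections b) (σ : Fin l → Bool)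
    {β : ι × ℤ} (hβ : IsPositive b β) (h : ¬IsPositive b (rootAct P (ev s σ)⁻¹ β)) :
    refl P β * ev s σ ∈ evSet s := by
  induction l with
  | zero => simp [ev, rootAct_one, hβ] at h
  | succ l ih =>
    have ih' := ih (Fin.init s) (Fin.init σ)
    rw [ev_succ] at h ⊢
    set y := ev (Fin.init s : Fin l → simpleReflections b) (Fin.init σ : Fin l → Bool)
    by_cases hy : IsPositive b (rootAct P y⁻¹ β)
    · cases hσ : σ (Fin.last l) with
      | false => simp [hσ, hy] at h
      | true =>
        have hα := simpleRoot_spec b (s (Fin.last l))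
        have hinv : (s (Fin.last l) : affineWeylGroup P)⁻¹ = s (Fin.last l) :=
          inv_eq_of_mul_eq_one_left (simple_mul_self b _)
        simp only [hσ, if_true, mul_inv_rev, hinv, rootAct_mul] at h
        conv at h => arg 1; arg 2; arg 2; rw [← hα.2]
        rw [rootAct_refl] at h
        have h1 : rootAct P y⁻¹ β = simpleRoot b (s (Fin.last l)) := by
          by_contra hne
          exact h (hα.1.isPositive_reflRoot b hy hne)
        have h2 : refl P β * y = y * s (Fin.last l) := by
          rw [← hα.2, ← h1, refl_rootAct]
          group
        refine ⟨Fin.snoc (α := fun _ => Bool) (Fin.init σ) false, ?_⟩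
        rw [ev_succ]
        simp only [Fin.init_snoc, Fin.snoc_last, if_true, ← mul_assoc, h2]
        rw [mul_simple_mul_simple]
        simp [y]
    · obtain ⟨τ, hτ⟩ := ih' hy
      refine ⟨Fin.snoc (α := fun _ => Bool) τ (σ (Fin.last l)), ?_⟩
      rw [ev_succ]
      simp only [Fin.init_snoc, Fin.snoc_last, hτ, mul_assoc]

/-- For an edge from `x` to `y = s_β x`, the root `y⁻¹(β) = -x⁻¹(β)` is negative, so the exchange
for subsequences applies at `y`. -/
theorem src_mem_evSet {l : ℕ} (s : Fin l → simpleReflections b) (e : (affineGraph b F).Edge)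
    (h : e.1.1.2 ∈ evSet s) : e.1.1.1 ∈ evSet s := by
  obtain ⟨σ, hσ⟩ := h
  have h1 : refl P e.1.2 * e.1.1.2 = e.1.1.1 := by
    rw [e.2.2.2, ← mul_assoc, refl_mul_self, one_mul]
  rw [← h1, ← hσ]
  refine refl_mul_ev_mem s σ e.2.1 ?_
  have h2 : (refl P e.1.2)⁻¹ = refl P e.1.2 := inv_eq_of_mul_eq_one_left (refl_mul_self P _)
  rw [hσ, e.2.2.2, mul_inv_rev, rootAct_mul, h2, rootAct_refl, rootAct_reflRoot_self,
    isPositive_reflRoot_self, not_not]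
  exact AffineEdge.isPositive F e

theorem mul_last_mem_evSet {l : ℕ} (s : Fin (l + 1) → simpleReflections b)
    {x : affineWeylGroup P} (h : x ∈ evSet s) : x * s (Fin.last l) ∈ evSet s := by
  obtain ⟨σ, rfl⟩ := h
  refine ⟨Fin.snoc (α := fun _ => Bool) (Fin.init σ) (!σ (Fin.last l)), ?_⟩
  rw [ev_succ, ev_succ s σ]
  cases h : σ (Fin.last l)
  · simp
  · simp [mul_simple_mul_simple]

theorem evSet_init_subset {l : ℕ} (s : Fin (l + 1) → simpleReflections b) :
    evSet (Fin.init s : Fin l → simpleReflections b) ⊆ evSet s := by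
  rintro _ ⟨σ, rfl⟩
  exact ⟨Fin.snoc (α := fun _ => Bool) σ false, by simp [ev_succ]⟩

end AffineGraph

/-! ### Nice sheaves and the extension of sections over cosets. -/

section Translation

variable {ι V N : Type u} [AddCommGroup V] [Module ℚ V] [AddCommGroup N] [Module ℚ N]
  {P : RootPairing ι ℚ V N} [P.IsCrystallographic] {b : P.Base} {F : Type u} [Field F]

local notation "ιS" => SymmetricAlgebra.ι F (LabelSpace P F)

theorem label_smul_edge (M : Sheaf F (affineGraph b F)) (e : (affineGraph b F).Edge)
    (m : M.edge e) : ιS (barRoot P F e.1.2) • m = 0 :=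
  M.label_smul e m

/-- Since the target is the reflection of the source in the root of the edge, the two factors differ
by a multiple of the label, which kills the edge module. -/
theorem twist_smul_edge (M : Sheaf F (affineGraph b F)) (e : (affineGraph b F).Edge)
    (ν : affineWeights P) (m : M.edge e) :
    ιS (bar P F (weylAct P e.1.1.2 ν)) • m = ιS (bar P F (weylAct P e.1.1.1 ν)) • m := by
  obtain ⟨d, hd⟩ := exists_bar_weylAct_refl P F e.1.2 (weylAct P e.1.1.1 ν)
  rw [← weylAct_mul, ← e.2.2.2] at hd
  rw [hd, map_add, map_smul, add_smul, Algebra.smul_def, mul_smul, label_smul_edge, smul_zero,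
    add_zero]

/-- The action of `c^ν` preserves global sections. -/
theorem twist_mem_globalSections (M : Sheaf F (affineGraph b F)) (ν : affineWeights P)
    {g : ∀ x, M.stalk x} (hg : g ∈ M.globalSections) :
    (fun x => ιS (bar P F (weylAct P x ν)) • g x) ∈ M.globalSections := by
  intro e
  refine (map_smul _ _ _).trans (Eq.trans ?_ (map_smul _ _ _).symm)
  refine (congrArg _ (hg e)).trans ?_
  exact (twist_smul_edge M e ν _).symm

/-- The restriction of a global section to the fibre of a coset. -/
def resFibre (s : simpleReflections b) (M : Sheaf F (affineGraph b F)) (a : Coset s)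
    {g : ∀ x, M.stalk x} (hg : g ∈ M.globalSections) : onStalk s M a :=
  ⟨fun y => g y, fun e _ _ => hg e⟩

/-- The properties of a sheaf on the moment graph that are preserved by translation functors:
it is supported on `J`, global sections surject onto stalks, the stalks `M^x` and the quotients
`M^x / w M^x` are torsion free over `S` and `S / w S`, the modules `M^E` are torsion free over
`S / l(E) S`, and the kernel of the restriction from the target of `E` is `l(E) M^y`. -/
structure IsNice (M : Sheaf F (affineGraph b F)) (J : Set (affineWeylGroup P)) : Prop where
  eq_zero : ∀ x ∉ J, ∀ m : M.stalk x, m = 0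
  exists_section : ∀ x (m : M.stalk x), ∃ g ∈ M.globalSections, g x = m
  stalk_torsionFree : ∀ x (f : SymAlg P F) (m : M.stalk x), f ≠ 0 → f • m = 0 → m = 0
  stalk_dvd : ∀ x (w : LabelSpace P F) (f : SymAlg P F) (m n : M.stalk x), w ≠ 0 →
    ¬ιS w ∣ f → f • m = ιS w • n → ∃ k, m = ιS w • k
  edge_torsionFree : ∀ (e : (affineGraph b F).Edge) (f : SymAlg P F) (m : M.edge e),
    ¬ιS (barRoot P F e.1.2) ∣ f → f • m = 0 → m = 0
  ker_resTgt : ∀ (e : (affineGraph b F).Edge) (m : M.stalk e.1.1.2), M.resTgt e m = 0 →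
    ∃ k, m = ιS (barRoot P F e.1.2) • k

section ThetaRes

variable (s : simpleReflections b) (M : Sheaf F (affineGraph b F))

theorem castStalk_thetaOn {a a' : Coset s} (h : a = a') (m : onStalk s M a)
    (y : affineWeylGroup P) (hy : toCoset s y = a') :
    ((thetaOn s M).castStalk h m : onStalk s M a').1 ⟨y, hy⟩ = m.1 ⟨y, hy.trans h.symm⟩ := by
  subst h
  rfl

/-- Compatibility along an edge of `ϑ^s M`, expressed in `M`: a congruence modulo the label inside a
coset, compatibility along `E` and `Es` otherwise. The hypothesis `hM` ensures that `onResSrc` is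
the intended map and not its default value zero. -/
theorem theta_resSrc_eq_resTgt_iff
    (hM : ∀ E m, onSrc s M E m ∈ LinearMap.range (onTgt s M E))
    (e : (affineGraph b F).Edge) (u : onStalk s M (toCoset s e.1.1.1))
    (v : onStalk s M (toCoset s e.1.1.2)) :
    (theta s M).resSrc e u = (theta s M).resTgt e v ↔
      (∀ h : toCoset s e.1.1.1 = toCoset s e.1.1.2, ∃ k : onStalk s M (toCoset s e.1.1.1),
        ∀ (y : affineWeylGroup P) (hy : toCoset s y = toCoset s e.1.1.1),
          u.1 ⟨y, hy⟩ - v.1 ⟨y, hy.trans h⟩ = ιS (barRoot P F e.1.2) • k.1 ⟨y, hy⟩) ∧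
      (toCoset s e.1.1.1 ≠ toCoset s e.1.1.2 → ∀ (e' : (affineGraph b F).Edge)
        (hs : toCoset s e'.1.1.1 = toCoset s e.1.1.1)
        (ht : toCoset s e'.1.1.2 = toCoset s e.1.1.2), e'.1.2 = e.1.2 →
          M.resSrc e' (u.1 ⟨_, hs⟩) = M.resTgt e' (v.1 ⟨_, ht⟩)) := by
  change outSrc s (thetaOn s M) e (Classical.propDecidable _) u =
    outTgt s (thetaOn s M) e (Classical.propDecidable _) v ↔ _
  generalize Classical.propDecidable _ = d
  cases d with
  | isTrue h =>
    rw [and_iff_left (fun h' => absurd h h'), forall_prop_of_true h]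
    refine (Submodule.Quotient.eq _).trans (exists_congr fun k => ?_)
    constructor
    · intro hk y hy
      have := congrArg (fun m : onStalk s M (toCoset s e.1.1.1) => m.1 ⟨y, hy⟩) hk
      refine Eq.trans ?_ this.symm
      exact congrArg (fun t => u.1 ⟨y, hy⟩ - t) (castStalk_thetaOn s M h.symm v y hy).symm
    · intro hk
      refine Subtype.ext (funext fun y => ?_)
      refine (hk y y.2).symm.trans ?_
      exact congrArg (fun t => u.1 y - t) (castStalk_thetaOn s M h.symm v y y.2).symm
  | isFalse h =>
    rw [and_iff_right (fun h' => absurd h' h), forall_prop_of_true h]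
    change onResSrc s M (coverEdge s e h) u = GrMod.codRestrict (onTgt s M _) _ _ _ v ↔ _
    rw [onResSrc, dif_pos (hM _)]
    refine Subtype.ext_iff.trans (funext_iff.trans ?_)
    constructor
    · intro H e' hs ht hl
      exact H ⟨e', hs, ht, hl⟩
    · rintro H ⟨e', hs, ht, hl⟩
      exact H e' hs ht hl

end ThetaRes

variable [Finite ι] [P.IsReduced] [P.IsIrreducible]

theorem half_mul_two (hF : (2 : F) ≠ 0) : algebraMap F (SymAlg P F) 2⁻¹ * 2 = 1 := by
  rw [← map_ofNat (algebraMap F (SymAlg P F)) 2, ← map_mul, inv_mul_cancel₀ hF, map_one]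

/-- Extend the value at the source of the edge joining `x` and `xs`. The error at the target lies in
the kernel of the restriction, so it has the form `βk`, and it is corrected by a global section that
vanishes at the source and equals `βk` at the target. -/
theorem IsNice.exists_section_fibre (hF : (2 : F) ≠ 0) {M : Sheaf F (affineGraph b F)}
    {J : Set (affineWeylGroup P)} (hM : IsNice M J) (s : simpleReflections b) (a : Coset s)
    (u : onStalk s M a) : ∃ g ∈ M.globalSections, ∀ y : fibre s a, g y = u.1 y := by
  obtain ⟨x, rfl⟩ := QuotientGroup.mk_surjective a
  obtain ⟨e, he, -⟩ := exists_edge_fibre F s x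
  have hs : toCoset s e.1.1.1 = toCoset s x := by
    rcases he with h | h
    · rw [h.1]
    · rw [h.1, toCoset_mul]
  have ht : toCoset s e.1.1.2 = toCoset s x := by
    rcases he with h | h
    · rw [h.2, toCoset_mul]
    · rw [h.2]
  have hy : ∀ y : fibre s (toCoset s x), y = ⟨_, hs⟩ ∨ y = ⟨_, ht⟩ := by
    intro y
    have hxy := toCoset_eq s (Eq.symm y.2)
    rcases he with h | h
    · exact hxy.imp (fun h' => Subtype.ext (h'.trans h.1.symm))
        fun h' => Subtype.ext (h'.trans h.2.symm)
    · exact hxy.symm.imp (fun h' => Subtype.ext (h'.trans h.1.symm))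
        fun h' => Subtype.ext (h'.trans h.2.symm)
  obtain ⟨g₀, hg₀, h₀⟩ := hM.exists_section e.1.1.1 (u.1 ⟨_, hs⟩)
  obtain ⟨k, hk⟩ := hM.ker_resTgt e (u.1 ⟨_, ht⟩ - g₀ e.1.1.2) (by
    have h1 := u.2 e hs ht
    have h2 := hg₀ e
    rw [map_sub, ← h1, sub_eq_zero]
    refine Eq.trans ?_ h2
    exact congrArg (M.resSrc e) h₀.symm)
  obtain ⟨g₁, hg₁, h₁⟩ := hM.exists_section e.1.1.2 k
  let β := barRoot P F e.1.2
  -- With this `ν`, `c^ν` acts as `β` at the source and as `s_β(β) = -β` at the target. Hence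
  -- `-½(c^ν - β)` acts as `0` and `β` respectively, which is where division by `2` enters.
  let ν := weylAct P e.1.1.1⁻¹ ⟨affineRoot P e.1.2, affineRoot_mem P e.1.2⟩
  have hν₁ : bar P F (weylAct P e.1.1.1 ν) = β := by
    rw [← weylAct_mul, mul_inv_cancel, weylAct_one]
  have hν₂ : bar P F (weylAct P e.1.1.2 ν) = -β := by
    rw [e.2.2.2, weylAct_mul, ← weylAct_mul _ e.1.1.1, mul_inv_cancel, weylAct_one,
      weylAct_affineRoot, rootAct_refl]
    exact barRoot_reflRoot_self P F _
  refine ⟨g₀ - algebraMap F (SymAlg P F) 2⁻¹ •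
    ((fun x => ιS (bar P F (weylAct P x ν)) • g₁ x) - ιS β • g₁),
    sub_mem hg₀ (Submodule.smul_mem _ _ (sub_mem (twist_mem_globalSections M ν hg₁)
      (Submodule.smul_mem _ _ hg₁))), fun y => ?_⟩
  rcases hy y with rfl | rfl
  · change g₀ e.1.1.1 - algebraMap F (SymAlg P F) 2⁻¹ •
      (ιS (bar P F (weylAct P e.1.1.1 ν)) • g₁ e.1.1.1 - ιS β • g₁ e.1.1.1) = _
    rw [hν₁, sub_self, smul_zero, sub_zero, h₀]
  · change g₀ e.1.1.2 - algebraMap F (SymAlg P F) 2⁻¹ •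
      (ιS (bar P F (weylAct P e.1.1.2 ν)) • g₁ e.1.1.2 - ιS β • g₁ e.1.1.2) = _
    rw [hν₂, h₁, map_neg]
    have h2 : algebraMap F (SymAlg P F) 2⁻¹ • (-ιS β • k - ιS β • k) = -(ιS β • k) := by
      rw [← sub_smul, smul_smul,
        show algebraMap F (SymAlg P F) 2⁻¹ * (-ιS β - ιS β) =
          (algebraMap F (SymAlg P F) 2⁻¹ * 2) * -ιS β by ring, half_mul_two hF, one_mul, neg_smul]
    rw [h2, ← hk]
    abel

/-- A section over the source coset extends globally; restricting the extension to the target coset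
gives a preimage. -/
theorem IsNice.onSrc_mem_range (hF : (2 : F) ≠ 0) {M : Sheaf F (affineGraph b F)}
    {J : Set (affineWeylGroup P)} (hM : IsNice M J) (s : simpleReflections b)
    (E : (cosetGraph s F).Edge) (m : onStalk s M ((cosetGraph s F).src E)) :
    onSrc s M E m ∈ LinearMap.range (onTgt s M E) := by
  obtain ⟨g, hg, h⟩ := hM.exists_section_fibre hF s _ m
  refine ⟨resFibre s M _ hg, funext fun e => ?_⟩
  refine (hg e.1).symm.trans ?_
  exact congrArg (M.resSrc e.1) (h ⟨e.1.1.1.1, e.2.1⟩)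

end Translation

/-! ### Translation preserves niceness. -/

section Preservation

variable {ι V N : Type u} [AddCommGroup V] [Module ℚ V] [AddCommGroup N] [Module ℚ N]
  {P : RootPairing ι ℚ V N} [P.IsCrystallographic] {b : P.Base} {F : Type u} [Field F]
  [Finite ι] [P.IsReduced] [P.IsIrreducible]

local notation "ιS" => SymmetricAlgebra.ι F (LabelSpace P F)

variable {M : Sheaf F (affineGraph b F)} {J : Set (affineWeylGroup P)}

theorem IsNice.onStalk_torsionFree (hM : IsNice M J) (s : simpleReflections b) (a : Coset s) (f : SymAlg P F) (m : onStalk s M a)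
    (hf : f ≠ 0) (h : f • m = 0) : m = 0 :=
  Subtype.ext (funext fun y => hM.stalk_torsionFree _ f _ hf
    (congrFun (congrArg Subtype.val h) y))

/-- The quotients exist at each vertex of the coset, and they must be shown to agree along an edge.
If the label does not divide `w`, cancel `w` and use that `m` is a section. If it does, it is
proportional to `w`, so it does not divide `f`; cancel `f` and use that `n` is a section. -/
theorem IsNice.onStalk_dvd (hM : IsNice M J) (s : simpleReflections b)
    (a : Coset s) (w : LabelSpace P F) (f : SymAlg P F) (m n : onStalk s M a) (hw : w ≠ 0) (hf : ¬ιS w ∣ f) (h : f • m = ιS w • n) :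
    ∃ k : onStalk s M a, m = ιS w • k := by
  have hy : ∀ y : fibre s a, f • m.1 y = ιS w • n.1 y := fun y =>
    congrFun (congrArg Subtype.val h) y
  choose k hk using fun y : fibre s a => hM.stalk_dvd _ w f _ _ hw hf (hy y)
  have hw' : ιS w ≠ 0 := (prime_ι hw).ne_zero
  have hn : ∀ y : fibre s a, f • k y = n.1 y := fun y => by
    refine sub_eq_zero.1 (hM.stalk_torsionFree _ _ _ hw' ?_)
    rw [smul_sub, ← hy, hk, smul_smul, smul_smul, mul_comm, sub_self]
  refine ⟨⟨k, fun e hs ht => ?_⟩, Subtype.ext (funext hk)⟩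
  change M.resSrc e (k ⟨_, hs⟩) = M.resTgt e (k ⟨_, ht⟩)
  have h1 := m.2 e hs ht
  have h2 := n.2 e hs ht
  by_cases hd : ιS (barRoot P F e.1.2) ∣ ιS w
  · have hd' : ¬ιS (barRoot P F e.1.2) ∣ f := by
      obtain ⟨c, hc⟩ := exists_smul_eq_of_ι_dvd hd
      have hc0 : c ≠ 0 := by
        rintro rfl
        exact hw (by rw [hc, zero_smul])
      intro hd'
      refine hf ?_
      obtain ⟨g, rfl⟩ := hd'
      exact ⟨c⁻¹ • g, by rw [hc, map_smul, smul_mul_smul_comm, mul_inv_cancel₀ hc0, one_smul]⟩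
    refine sub_eq_zero.1 (hM.edge_torsionFree e f _ hd' ?_)
    rw [smul_sub, ← map_smul, ← map_smul, hn, hn, sub_eq_zero]
    exact h2
  · refine sub_eq_zero.1 (hM.edge_torsionFree e _ _ hd ?_)
    rw [smul_sub, ← map_smul, ← map_smul, ← hk, ← hk, sub_eq_zero]
    exact h1

theorem mem_of_toCoset_eq (s : simpleReflections b) (hJ : ∀ x ∈ J, x * s ∈ J) {x y : affineWeylGroup P}
    (h : toCoset s x = toCoset s y) (hx : x ∈ J) :
    y ∈ J := by
  rcases toCoset_eq s h with rfl | rfl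
  · exact hx
  · exact hJ _ hx

theorem not_dvd_of_GKM (hGKM : (affineGraph b F).GKM F J) {e e' : (affineGraph b F).Edge} (h1 : e.1.1.1 ∈ J) (h2 : e.1.1.2 ∈ J)
    (h3 : e'.1.1.1 ∈ J) (h4 : e'.1.1.2 ∈ J) (hne : e ≠ e')
    (hx : ∃ x, Nonempty ((affineGraph b F).Inc x e) ∧ Nonempty ((affineGraph b F).Inc x e')) :
    ¬ιS (barRoot P F e.1.2) ∣ ιS (barRoot P F e'.1.2) := fun h => by
  obtain ⟨c, hc⟩ := exists_smul_eq_of_ι_dvd h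
  exact hGKM e e' h1 h2 h3 h4 hne hx c hc

theorem IsNice.resFibre_mem_globalSections (hM : IsNice M J) (s : simpleReflections b)
    (hF : (2 : F) ≠ 0) {g : ∀ x, M.stalk x} (hg : g ∈ M.globalSections) :
    (fun x => resFibre s M (toCoset s x) hg : ∀ x, (theta s M).stalk x) ∈
      (theta s M).globalSections := fun e =>
  (theta_resSrc_eq_resTgt_iff s M (hM.onSrc_mem_range hF s) e _ _).2
    ⟨fun _ => ⟨0, fun _ _ => (sub_self _).trans (smul_zero _).symm⟩, fun _ e' _ _ _ => hg e'⟩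

theorem IsNice.theta_edge_torsionFree (hM : IsNice M J) (s : simpleReflections b)
    (hF : (2 : F) ≠ 0) (e : (affineGraph b F).Edge) (f : SymAlg P F)
    (hf : ¬ιS (barRoot P F e.1.2) ∣ f) :
    ∀ (d : _) (m : outEdge s (thetaOn s M) e d), f • m = 0 → m = 0
  | .isTrue h => by
    intro m hm
    obtain ⟨m, rfl⟩ := Submodule.mkQ_surjective _ m
    obtain ⟨n, hn⟩ := (Submodule.Quotient.mk_eq_zero _).1 hm
    obtain ⟨k, hk⟩ := hM.onStalk_dvd s _ _ f m n (barRoot_ne_zero P F hF _) hf hn.symm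
    exact (Submodule.Quotient.mk_eq_zero _).2 ⟨k, hk.symm⟩
  | .isFalse h => by
    intro m hm
    refine Subtype.ext (funext fun e' => hM.edge_torsionFree e'.1 f _ ?_
      (congrFun (congrArg Subtype.val hm) e'))
    rw [e'.2.2.2]
    exact hf

/-- Since `v` dies on both `E` and `Es`, each of its two components is divisible by the common
label. The quotients form a section over the coset because that label can be cancelled on the edge
inside the coset, by the GKM-property. -/
theorem IsNice.exists_onStalk_eq_smul (hM : IsNice M J) (s : simpleReflections b)
    (hJ : ∀ x ∈ J, x * s ∈ J) (hJ' : ∀ e : (affineGraph b F).Edge, e.1.1.2 ∈ J → e.1.1.1 ∈ J)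
    (hGKM : (affineGraph b F).GKM F J) (e : (affineGraph b F).Edge)
    (h : toCoset s e.1.1.1 ≠ toCoset s e.1.1.2) (v : onStalk s M (toCoset s e.1.1.2))
    (hv : ∀ (e' : (affineGraph b F).Edge) (_ : toCoset s e'.1.1.1 = toCoset s e.1.1.1)
      (ht : toCoset s e'.1.1.2 = toCoset s e.1.1.2), e'.1.2 = e.1.2 →
      M.resTgt e' (v.1 ⟨_, ht⟩) = 0) :
    ∃ k : onStalk s M (toCoset s e.1.1.2), v = ιS (barRoot P F e.1.2) • k := by
  have key : ∀ (e' : (affineGraph b F).Edge) (_ : toCoset s e'.1.1.1 = toCoset s e.1.1.1)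
      (y : fibre s (toCoset s e.1.1.2)), e'.1.1.2 = y.1 → e'.1.2 = e.1.2 →
      ∃ k, v.1 y = ιS (barRoot P F e.1.2) • k := by
    rintro e' hs ⟨y, hy⟩ rfl hl
    rw [← hl]
    exact hM.ker_resTgt e' _ (hv e' hs hy hl)
  have hv' : ∀ y : fibre s (toCoset s e.1.1.2), ∃ k, v.1 y = ιS (barRoot P F e.1.2) • k := by
    intro y
    rcases toCoset_eq s (Eq.symm y.2) with hy | hy
    · exact key e rfl y hy.symm rfl
    · obtain ⟨e', h1, h2, h3⟩ := exists_edge_mul F s e h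
      exact key e' (by rw [h1, toCoset_mul]) y (h2.trans hy.symm) h3
  choose k hk using hv'
  refine ⟨⟨k, fun e' hs ht => ?_⟩, Subtype.ext (funext hk)⟩
  change M.resSrc e' (k ⟨_, hs⟩) = M.resTgt e' (k ⟨_, ht⟩)
  by_cases hJe : e.1.1.2 ∈ J
  · have hs' : e'.1.1.1 ∈ J := mem_of_toCoset_eq s hJ (Eq.symm hs) hJe
    have ht' : e'.1.1.2 ∈ J := mem_of_toCoset_eq s hJ (Eq.symm ht) hJe
    have hne : e' ≠ e := by
      rintro rfl
      exact h hs
    -- The edge `e'` joins the two elements of the target coset, so it shares the target of `e`, as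
    -- the GKM-property requires.
    have hx : Nonempty ((affineGraph b F).Inc e.1.1.2 e') := by
      have hxy : e'.1.1.2 = e'.1.1.1 * s :=
        (toCoset_eq s (Eq.trans hs (Eq.symm ht))).resolve_left (src_ne_tgt F e').symm
      rcases toCoset_eq s hs with h1 | h1
      · rw [h1]
        exact ⟨LabelledGraph.Inc.src e'⟩
      · rw [h1, ← hxy]
        exact ⟨LabelledGraph.Inc.tgt e'⟩
    refine sub_eq_zero.1 (hM.edge_torsionFree e' (ιS (barRoot P F e.1.2)) _
      (not_dvd_of_GKM hGKM hs' ht' (hJ' e hJe) hJe hne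
        ⟨e.1.1.2, hx, ⟨LabelledGraph.Inc.tgt e⟩⟩) ?_)
    rw [smul_sub, ← map_smul, ← map_smul, ← hk, ← hk, sub_eq_zero]
    exact v.2 e' hs ht
  · have hz : ∀ y : fibre s (toCoset s e.1.1.2), ∀ m : M.stalk y, m = 0 := fun y =>
      hM.eq_zero _ fun hy => hJe (mem_of_toCoset_eq s hJ y.2 hy)
    rw [hz ⟨_, hs⟩ (k ⟨_, hs⟩), hz ⟨_, ht⟩ (k ⟨_, ht⟩), map_zero, map_zero]

/-- The translate of a nice sheaf is again nice. -/
theorem IsNice.theta (hM : IsNice M J) (s : simpleReflections b) (hF : (2 : F) ≠ 0)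
    (hJ : ∀ x ∈ J, x * s ∈ J) (hJ' : ∀ e : (affineGraph b F).Edge, e.1.1.2 ∈ J → e.1.1.1 ∈ J)
    (hGKM : (affineGraph b F).GKM F J) : IsNice (theta s M) J where
  eq_zero x hx m := Subtype.ext (funext fun y => hM.eq_zero _
    (fun hy => hx (mem_of_toCoset_eq s hJ y.2 hy)) _)
  exists_section x m := by
    obtain ⟨g, hg, h⟩ := hM.exists_section_fibre hF s _ m
    exact ⟨_, hM.resFibre_mem_globalSections s hF hg, Subtype.ext (funext h)⟩
  stalk_torsionFree x := hM.onStalk_torsionFree s _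
  stalk_dvd x := hM.onStalk_dvd s _
  edge_torsionFree e f m hf := hM.theta_edge_torsionFree s hF e f hf _ m
  ker_resTgt e v hv := by
    have h0 := (theta_resSrc_eq_resTgt_iff s M (hM.onSrc_mem_range hF s) e 0 v).1
      (by rw [hv]; exact map_zero _)
    by_cases h : toCoset s e.1.1.1 = toCoset s e.1.1.2
    · obtain ⟨k, hk⟩ := h0.1 h
      refine ⟨-⟨fun y => k.1 ⟨y, Eq.trans y.2 h.symm⟩, fun e' hs ht =>
        k.2 e' (Eq.trans hs h.symm) (Eq.trans ht h.symm)⟩, Subtype.ext (funext fun y => ?_)⟩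
      have h1 := hk y.1 (Eq.trans y.2 h.symm)
      change 0 - v.1 y = _ at h1
      rw [zero_sub, neg_eq_iff_eq_neg, ← smul_neg] at h1
      exact h1
    · exact hM.exists_onStalk_eq_smul s hJ hJ' hGKM e h v fun e' hs ht hl =>
        (h0.2 h e' hs ht hl).symm.trans (map_zero _)

end Preservation

/-! ### Decomposition of the global sections of a translate. -/

section Decomposition

variable {ι V N : Type u} [AddCommGroup V] [Module ℚ V] [AddCommGroup N] [Module ℚ N]
  {P : RootPairing ι ℚ V N} [P.IsCrystallographic] {b : P.Base} {F : Type u} [Field F]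
  [Finite ι] [P.IsReduced] [P.IsIrreducible]

local notation "ιS" => SymmetricAlgebra.ι F (LabelSpace P F)

variable {M : Sheaf F (affineGraph b F)} {J : Set (affineWeylGroup P)}

/-- Transport of a section over a fibre along an equality of cosets. -/
def onStalkCast (s : simpleReflections b) {a a' : Coset s} (h : a = a') (k : onStalk s M a) :
    onStalk s M a' :=
  ⟨fun y => k.1 ⟨y, Eq.trans y.2 h.symm⟩, fun e hs ht =>
    k.2 e (Eq.trans hs h.symm) (Eq.trans ht h.symm)⟩

/-- The edge joining `x` and `xs` may point either way and its label is `±x(α)`; both signs are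
absorbed into `k`. -/
theorem IsNice.exists_sub_eq_twist (hM : IsNice M J) (s : simpleReflections b)
    (hF : (2 : F) ≠ 0) {m : ∀ x, onStalk s M (toCoset s x)}
    (hm : m ∈ (BottSamelson.theta s M).globalSections) (x : affineWeylGroup P) :
    ∃ k : onStalk s M (toCoset s x), ∀ (y : affineWeylGroup P) (hy : toCoset s y = toCoset s x),
      (m x).1 ⟨y, hy⟩ - (m (x * s)).1 ⟨y, hy.trans (toCoset_mul s x).symm⟩ =
        ιS (bar P F (twist b s x)) • k.1 ⟨y, hy⟩ := by
  have key : ∀ (e : (affineGraph b F).Edge) (p q : affineWeylGroup P), e.1.1.1 = p → e.1.1.2 = q →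
      ∀ h : toCoset s p = toCoset s q, ∃ k : onStalk s M (toCoset s p),
        ∀ (y : affineWeylGroup P) (hy : toCoset s y = toCoset s p),
          (m p).1 ⟨y, hy⟩ - (m q).1 ⟨y, hy.trans h⟩ =
            ιS (barRoot P F e.1.2) • k.1 ⟨y, hy⟩ := by
    rintro e _ _ rfl rfl h
    exact ((theta_resSrc_eq_resTgt_iff s M (hM.onSrc_mem_range hF s) e _ _).1 (hm e)).1 h
  have hxs := toCoset_mul s x
  obtain ⟨e, he, hl⟩ := exists_edge_fibre F s x
  obtain ⟨k, hk⟩ : ∃ k : onStalk s M (toCoset s x),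
      ∀ (y : affineWeylGroup P) (hy : toCoset s y = toCoset s x),
      (m x).1 ⟨y, hy⟩ - (m (x * s)).1 ⟨y, hy.trans hxs.symm⟩ =
        ιS (barRoot P F e.1.2) • k.1 ⟨y, hy⟩ := by
    rcases he with he | he
    · exact key e _ _ he.1 he.2 hxs.symm
    · obtain ⟨k, hk⟩ := key e _ _ he.1 he.2 hxs
      refine ⟨-onStalkCast s hxs k, fun y hy => ?_⟩
      have h1 := hk y (hy.trans hxs.symm)
      rw [← neg_sub, h1, ← smul_neg]
      rfl
  rcases hl with hl | hl
  · exact ⟨k, fun y hy => by rw [hk, hl]⟩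
  · refine ⟨-k, fun y hy => ?_⟩
    rw [hk, hl, map_neg, neg_smul, ← smul_neg]
    rfl

/-- Up to sign `x(α)` is the label of the edge joining `x` and `xs`, which lies in `J`, meets `e` at
`x` and differs from it. -/
theorem IsNice.not_dvd_twist (s : simpleReflections b) (hJ : ∀ x ∈ J, x * s ∈ J)
    (hGKM : (affineGraph b F).GKM F J) (e : (affineGraph b F).Edge)
    (hs : e.1.1.1 ∈ J) (ht : e.1.1.2 ∈ J) (h : toCoset s e.1.1.1 ≠ toCoset s e.1.1.2) :
    ¬ιS (barRoot P F e.1.2) ∣ ιS (bar P F (twist b s e.1.1.1)) := by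
  obtain ⟨e₀, he, hl⟩ := exists_edge_fibre F s e.1.1.1
  have hc : toCoset s e₀.1.1.1 = toCoset s e₀.1.1.2 := by
    rcases he with he | he
    · rw [he.1, he.2, toCoset_mul]
    · rw [he.1, he.2, toCoset_mul]
  have hne : e ≠ e₀ := by
    rintro rfl
    exact h hc
  have hs₀ : e₀.1.1.1 ∈ J := by
    rcases he with he | he
    · rw [he.1]; exact hs
    · rw [he.1]; exact hJ _ hs
  have ht₀ : e₀.1.1.2 ∈ J := mem_of_toCoset_eq s hJ hc hs₀
  have hd := not_dvd_of_GKM hGKM hs ht hs₀ ht₀ hne ⟨e.1.1.1, ⟨LabelledGraph.Inc.src e⟩, by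
    rcases he with he | he
    · rw [← he.1]; exact ⟨LabelledGraph.Inc.src e₀⟩
    · rw [← he.2]; exact ⟨LabelledGraph.Inc.tgt e₀⟩⟩
  rcases hl with hl | hl
  · rwa [← hl]
  · rwa [← neg_neg (bar P F _), ← hl, map_neg, dvd_neg]

theorem resSrc_halves (M : Sheaf F (affineGraph b F)) (e : (affineGraph b F).Edge)
    (c : SymAlg P F) {u v : M.stalk e.1.1.1} {u' v' : M.stalk e.1.1.2}
    (hu : M.resSrc e u = M.resTgt e u') (hv : M.resSrc e v = M.resTgt e v') :
    M.resSrc e (c • (u + v)) = M.resTgt e (c • (u' + v')) := by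
  rw [map_smul, map_smul, map_add, map_add]
  exact congrArg (c • ·) (congrArg₂ (· + ·) hu hv)

theorem resSrc_smul (M : Sheaf F (affineGraph b F)) (e : (affineGraph b F).Edge)
    (c : SymAlg P F) {u : M.stalk e.1.1.1} {u' : M.stalk e.1.1.2}
    (hu : M.resSrc e u = M.resTgt e u') : M.resSrc e (c • u) = M.resTgt e (c • u') := by
  rw [map_smul, map_smul]
  exact congrArg (c • ·) hu

/-- The factors act equally on the edge module, so both restrictions have the same multiple by `f`,
and `f` can be cancelled there. -/
theorem resSrc_eq_of_sub_eq_smul (M : Sheaf F (affineGraph b F)) (e : (affineGraph b F).Edge)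
    {f f' : SymAlg P F} {u v w : M.stalk e.1.1.1} {u' v' w' : M.stalk e.1.1.2}
    (hu : M.resSrc e u = M.resTgt e u') (hv : M.resSrc e v = M.resTgt e v')
    (hw : u - v = f • w) (hw' : u' - v' = f' • w') (hf : ∀ m : M.edge e, f' • m = f • m)
    (hf' : ∀ m : M.edge e, f • m = 0 → m = 0) : M.resSrc e w = M.resTgt e w' := by
  refine sub_eq_zero.1 (hf' _ ?_)
  have h1 := congrArg (M.resSrc e) hw
  have h2 := congrArg (M.resTgt e) hw'
  rw [map_smul, map_sub] at h1 h2
  rw [hf] at h2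
  rw [smul_sub, sub_eq_zero, ← h1]
  refine Eq.trans ?_ h2
  exact congrArg₂ (· - ·) hu hv

/-- Every global section of `ϑ^s M` is of the form `Δ(a) + c^α Δ(c)` for global sections `a` and
`c` of `M`. -/
theorem IsNice.exists_eq_add_twist (hM : IsNice M J) (s : simpleReflections b)
    (hF : (2 : F) ≠ 0) (hJ : ∀ x ∈ J, x * s ∈ J)
    (hJ' : ∀ e : (affineGraph b F).Edge, e.1.1.2 ∈ J → e.1.1.1 ∈ J)
    (hGKM : (affineGraph b F).GKM F J) {m : ∀ x, onStalk s M (toCoset s x)}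
    (hm : m ∈ (BottSamelson.theta s M).globalSections) :
    ∃ a ∈ M.globalSections, ∃ c ∈ M.globalSections, ∀ x (y : fibre s (toCoset s x)),
      (m x).1 y = a y + ιS (bar P F (twist b s x)) • c y := by
  choose k hk using hM.exists_sub_eq_twist s hF hm
  have hxs := toCoset_mul s
  have hcast : ∀ (x x' y : affineWeylGroup P) (h : x = x') (hy : toCoset s y = toCoset s x),
      (m x).1 ⟨y, hy⟩ = (m x').1 ⟨y, hy.trans (congrArg _ h)⟩ := by
    rintro x _ y rfl hy
    rfl
  -- Replacing `x` by `xs` negates both the difference and `x(α)`, so the quotient depends only on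
  -- the coset.
  have hkk : ∀ (x y : affineWeylGroup P) (hy : toCoset s y = toCoset s x),
      (k (x * s)).1 ⟨y, hy.trans (hxs x).symm⟩ = (k x).1 ⟨y, hy⟩ := by
    intro x y hy
    have h1 := hk x y hy
    have h2 := hk (x * s) y (hy.trans (hxs x).symm)
    rw [hcast (x * s * s) x y (mul_simple_mul_simple s x), bar_twist_mul, map_neg, neg_smul] at h2
    refine sub_eq_zero.1 (hM.stalk_torsionFree _ (ιS (bar P F (twist b s x))) _
      (prime_ι (bar_twist_ne_zero F hF s x)).ne_zero ?_)
    rw [smul_sub, ← h1, ← neg_eq_iff_eq_neg.2 h2]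
    abel
  have hres : ∀ (e e' : (affineGraph b F).Edge) (p q : affineWeylGroup P), e.1.1.1 = p →
      e.1.1.2 = q → toCoset s p ≠ toCoset s q → ∀ (hs : toCoset s e'.1.1.1 = toCoset s p)
      (ht : toCoset s e'.1.1.2 = toCoset s q), e'.1.2 = e.1.2 →
      M.resSrc e' ((m p).1 ⟨_, hs⟩) = M.resTgt e' ((m q).1 ⟨_, ht⟩) := by
    rintro e e' _ _ rfl rfl h hs ht hl
    exact ((theta_resSrc_eq_resTgt_iff s M (hM.onSrc_mem_range hF s) e _ _).1 (hm e)).2 h e' hs ht hl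
  have hres₁ : ∀ e : (affineGraph b F).Edge, toCoset s e.1.1.1 ≠ toCoset s e.1.1.2 →
      M.resSrc e ((m e.1.1.1).1 ⟨_, rfl⟩) = M.resTgt e ((m e.1.1.2).1 ⟨_, rfl⟩) := fun e h =>
    hres e e _ _ rfl rfl h rfl rfl rfl
  -- The edges `E` and `Es` have the same image in the quotient graph, so compatibility of `m` along
  -- `Es` also controls the restrictions to `E`.
  have hres₂ : ∀ e : (affineGraph b F).Edge, toCoset s e.1.1.1 ≠ toCoset s e.1.1.2 →
      M.resSrc e ((m (e.1.1.1 * s)).1 ⟨_, (hxs _).symm⟩) =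
        M.resTgt e ((m (e.1.1.2 * s)).1 ⟨_, (hxs _).symm⟩) := fun e h => by
    obtain ⟨e', h1, h2, h3⟩ := exists_edge_mul F s e h
    exact hres e' e _ _ h1 h2 (by rwa [hxs, hxs]) (hxs _).symm (hxs _).symm h3.symm
  let half : SymAlg P F := algebraMap F (SymAlg P F) 2⁻¹
  have hhalf : half * 2 = 1 := half_mul_two hF
  let a : ∀ x, M.stalk x := fun x =>
    -- The sum is symmetric in `x` and `xs`, so `a` may be computed from either element of a coset.
    half • ((m x).1 ⟨x, rfl⟩ + (m (x * s)).1 ⟨x, (hxs x).symm⟩)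
  let c : ∀ x, M.stalk x := fun x => half • (k x).1 ⟨x, rfl⟩
  have ha : ∀ (x y : affineWeylGroup P) (hy : toCoset s y = toCoset s x),
      a y = half • ((m x).1 ⟨y, hy⟩ + (m (x * s)).1 ⟨y, hy.trans (hxs x).symm⟩) := by
    intro x y hy
    rcases toCoset_eq s hy.symm with rfl | rfl
    · rfl
    · rw [add_comm, ← hcast (x * s * s) x _ (mul_simple_mul_simple s x)]
  have hc : ∀ (x y : affineWeylGroup P) (hy : toCoset s y = toCoset s x),
      c y = half • (k x).1 ⟨y, hy⟩ := by
    intro x y hy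
    rcases toCoset_eq s hy.symm with rfl | rfl
    · rfl
    · exact congrArg (half • ·) (hkk x _ hy)
  refine ⟨a, fun e => ?_, c, fun e => ?_, fun x y => ?_⟩
  · change M.resSrc e (a e.1.1.1) = M.resTgt e (a e.1.1.2)
    by_cases h : toCoset s e.1.1.1 = toCoset s e.1.1.2
    · rw [ha e.1.1.1 e.1.1.1 rfl, ha e.1.1.1 e.1.1.2 h.symm]
      exact resSrc_halves M e half ((m e.1.1.1).2 e rfl h.symm)
        ((m (e.1.1.1 * s)).2 e (hxs _).symm (h.symm.trans (hxs _).symm))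
    · exact resSrc_halves M e half (hres₁ e h) (hres₂ e h)
  · change M.resSrc e (c e.1.1.1) = M.resTgt e (c e.1.1.2)
    by_cases h : toCoset s e.1.1.1 = toCoset s e.1.1.2
    · rw [hc e.1.1.1 e.1.1.1 rfl, hc e.1.1.1 e.1.1.2 h.symm]
      exact resSrc_smul M e half ((k e.1.1.1).2 e rfl h.symm)
    · by_cases hJe : e.1.1.2 ∈ J
      · have hd := IsNice.not_dvd_twist s hJ hGKM e (hJ' e hJe) hJe h
        exact resSrc_smul M e half (resSrc_eq_of_sub_eq_smul M e (hres₁ e h) (hres₂ e h)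
          (hk e.1.1.1 e.1.1.1 rfl) (hk e.1.1.2 e.1.1.2 rfl) (twist_smul_edge M e _)
          fun n => hM.edge_torsionFree e _ n hd)
      -- The stalk at the target is zero. A global section through `c` at the source therefore shows
      -- that `c` restricts to zero there.
      · obtain ⟨g, hg, h1⟩ := hM.exists_section _ (c e.1.1.1)
        rw [hM.eq_zero _ hJe (c e.1.1.2), map_zero, ← h1]
        refine (hg e).trans ?_
        exact (congrArg _ (hM.eq_zero _ hJe _)).trans (map_zero _)
  · rw [ha x y y.2, hc x y y.2, smul_comm, ← hk x y y.2, ← smul_add]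
    rw [add_add_sub_cancel, ← two_smul (SymAlg P F), smul_smul, hhalf, one_smul]

theorem IsNice.add_twist_mem_globalSections (hM : IsNice M J) (s : simpleReflections b)
    (hF : (2 : F) ≠ 0) {a c : ∀ x, M.stalk x} (ha : a ∈ M.globalSections)
    (hc : c ∈ M.globalSections) :
    (fun x => resFibre s M (toCoset s x) ha + ιS (bar P F (twist b s x)) •
      resFibre s M (toCoset s x) hc : ∀ x, (BottSamelson.theta s M).stalk x) ∈
      (BottSamelson.theta s M).globalSections :=
  add_mem (hM.resFibre_mem_globalSections s hF ha)
    (twist_mem_globalSections (BottSamelson.theta s M) _ (hM.resFibre_mem_globalSections s hF hc))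

end Decomposition

/-! ### The unit sheaf, coordinates on Bott–Samelson sheaves, and the comparison. -/

section UnitSheaf

variable {ι V N : Type u} [AddCommGroup V] [Module ℚ V] [AddCommGroup N] [Module ℚ N]
  {P : RootPairing ι ℚ V N} [P.IsCrystallographic] {b : P.Base} {F : Type u} [Field F]

local notation "ιS" => SymmetricAlgebra.ι F (LabelSpace P F)

/-- The isomorphism given by an equality of graded modules. -/
def GrMod.equivOfEq {W : Type u} [AddCommGroup W] [Module F W] {A B : GrMod F W} (h : A = B) :
    A ≃ₗ[SymmetricAlgebra F W] B :=
  h ▸ LinearEquiv.refl _ _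

theorem unitSheaf_stalk_eq_sym {x : affineWeylGroup P} (hx : x = 1) :
    (unitSheaf b F).stalk x = GrMod.sym F (LabelSpace P F) :=
  if_pos hx

theorem unitSheaf_stalk_eq_zero {x : affineWeylGroup P} (hx : x ≠ 1)
    (m : (unitSheaf b F).stalk x) : m = 0 := by
  have h : (unitSheaf b F).stalk x = GrMod.zero := if_neg hx
  have key : ∀ A : GrMod F (LabelSpace P F), A = GrMod.zero → ∀ m : A, m = 0 := by
    rintro _ rfl m
    rfl
  exact key _ h m

open Classical in
theorem single_mem_globalSections_unitSheaf (x : affineWeylGroup P)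
    (m : (unitSheaf b F).stalk x) :
    Pi.single (M := fun x => (unitSheaf b F).stalk x) x m ∈ (unitSheaf b F).globalSections :=
  fun _ => rfl

theorem IsNice.mono {M : Sheaf F (affineGraph b F)} {J J' : Set (affineWeylGroup P)}
    (hM : IsNice M J) (h : J ⊆ J') : IsNice M J' where
  __ := hM
  eq_zero x hx := hM.eq_zero x fun hx' => hx (h hx')

variable [Finite ι] [P.IsReduced] [P.IsIrreducible]

theorem isNice_unitSheaf : IsNice (unitSheaf b F) {1} where
  eq_zero x hx m := unitSheaf_stalk_eq_zero hx m
  exists_section x m := by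
    classical
    exact ⟨_, single_mem_globalSections_unitSheaf x m, Pi.single_eq_same _ _⟩
  stalk_torsionFree x f m hf h := by
    by_cases hx : x = 1
    · have key : ∀ A : GrMod F (LabelSpace P F), A = GrMod.sym F (LabelSpace P F) →
          ∀ m : A, f • m = 0 → m = 0 := by
        rintro _ rfl m hm
        exact (mul_eq_zero.1 hm).resolve_left hf
      exact key _ (unitSheaf_stalk_eq_sym hx) m h
    · exact unitSheaf_stalk_eq_zero hx m
  stalk_dvd x w f m n hw hf h := by
    by_cases hx : x = 1
    · have key : ∀ A : GrMod F (LabelSpace P F), A = GrMod.sym F (LabelSpace P F) →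
          ∀ m n : A, f • m = ιS w • n → ∃ k : A, m = ιS w • k := by
        rintro _ rfl m n hm
        exact ((prime_ι hw).dvd_or_dvd ⟨n, hm⟩).resolve_left hf
      exact key _ (unitSheaf_stalk_eq_sym hx) m n h
    · exact ⟨0, by rw [unitSheaf_stalk_eq_zero hx m, smul_zero]⟩
  edge_torsionFree e f m _ _ := rfl
  ker_resTgt e m _ := ⟨0, by rw [unitSheaf_stalk_eq_zero (tgt_ne_one F e) m, smul_zero]⟩

theorem GKM_mono {G : LabelledGraph (LabelSpace P F)} {J J' : Set G.Vert} (h : J ⊆ J')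
    (hG : G.GKM F J') : G.GKM F J :=
  fun e e' h1 h2 h3 h4 => hG e e' (h h1) (h h2) (h h3) (h h4)

/-- The induction enlarges the support from `J(s')` to `J(s)` before translating, because only the
latter is stable under right multiplication by the last reflection. -/
theorem isNice_bottSamelson (hF : (2 : F) ≠ 0) {l : ℕ} (s : Fin l → simpleReflections b)
    (hGKM : (affineGraph b F).GKM F (evSet s)) : IsNice (bottSamelson F s) (evSet s) := by
  induction l with
  | zero => exact isNice_unitSheaf.mono fun x hx => ⟨Fin.elim0, by rw [hx]; simp [ev]⟩
  | succ l ih =>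
    exact ((ih (Fin.init s) (GKM_mono (evSet_init_subset s) hGKM)).mono
      (evSet_init_subset s)).theta _ hF (fun x hx => mul_last_mem_evSet s hx)
      (fun e => src_mem_evSet F s e) hGKM

theorem mem_xModule_succ {l : ℕ} (s : Fin (l + 1) → simpleReflections b)
    (f : SeqModule P F (l + 1)) : f ∈ xModule F s ↔
      ∃ f₁ ∈ xModule F (Fin.init s : Fin l → simpleReflections b),
      ∃ f₂ ∈ xModule F (Fin.init s : Fin l → simpleReflections b), ∀ σ,
        f₁ (Fin.init σ : Fin l → Bool) + ιS (bar P F (twist b (s (Fin.last l)) (ev s σ))) *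
          f₂ (Fin.init σ : Fin l → Bool) = f σ := by
  rw [xModule, Submodule.mem_sup]
  constructor
  · rintro ⟨_, ⟨f₁, h₁, rfl⟩, _, ⟨_, ⟨f₂, h₂, rfl⟩, rfl⟩, rfl⟩
    exact ⟨f₁, h₁, f₂, h₂, fun σ => rfl⟩
  · rintro ⟨f₁, h₁, f₂, h₂, h⟩
    exact ⟨_, ⟨f₁, h₁, rfl⟩, _, ⟨_, ⟨f₂, h₂, rfl⟩, rfl⟩, funext h⟩

theorem map_add_smul_apply {A : Type u} {I : Type*} [AddCommGroup A] [Module (SymAlg P F) A]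
    (χ : A →ₗ[SymAlg P F] (I → SymAlg P F)) (a c : A) (f : SymAlg P F) (i : I) :
    χ (a + f • c) i = χ a i + f * χ c i := by
  rw [map_add, map_smul]
  rfl

/-- The stalks of the Bott–Samelson sheaf embed into direct sums of copies of `S`, such that the
image of the global sections is the module `X(s)`. -/
theorem exists_coordinates (hF : (2 : F) ≠ 0) {l : ℕ} (s : Fin l → simpleReflections b)
    (hGKM : (affineGraph b F).GKM F (evSet s)) :
    ∃ χ : ∀ x, (bottSamelson F s).stalk x →ₗ[SymAlg P F] ({σ // ev s σ = x} → SymAlg P F),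
      (∀ x, Function.Injective (χ x)) ∧ ∀ f : SeqModule P F l, f ∈ xModule F s ↔
        ∃ m ∈ (bottSamelson F s).globalSections, ∀ σ, χ (ev s σ) (m (ev s σ)) ⟨σ, rfl⟩ = f σ := by
  classical
  induction l with
  | zero =>
    have hev : ∀ σ, ev s σ = 1 := fun σ => by simp [ev]
    refine ⟨fun x => LinearMap.pi fun σ =>
      (GrMod.equivOfEq (unitSheaf_stalk_eq_sym (σ.2.symm.trans (hev _)))).toLinearMap,
      fun x => ?_, fun f => ⟨fun _ => ?_, fun _ => Submodule.mem_top⟩⟩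
    · rw [injective_iff_map_eq_zero]
      intro m hm
      by_cases hx : x = 1
      · subst hx
        exact (LinearEquiv.map_eq_zero_iff _).1 (congrFun hm ⟨Fin.elim0, hev _⟩)
      · exact unitSheaf_stalk_eq_zero hx m
    · refine ⟨_, single_mem_globalSections_unitSheaf 1
        ((GrMod.equivOfEq (unitSheaf_stalk_eq_sym rfl)).symm (f Fin.elim0)), fun σ => ?_⟩
      have key : ∀ x (hx : x = 1), GrMod.equivOfEq (unitSheaf_stalk_eq_sym (b := b) (F := F) hx)
          (Pi.single (M := fun x => (unitSheaf b F).stalk x) 1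
            ((GrMod.equivOfEq (unitSheaf_stalk_eq_sym rfl)).symm (f Fin.elim0)) x) =
          f Fin.elim0 := by
        rintro _ rfl
        rw [Pi.single_eq_same, LinearEquiv.apply_symm_apply]
      refine (key _ (hev σ)).trans ?_
      rw [Subsingleton.elim σ Fin.elim0]
  | succ l ih =>
    have hGKM' := GKM_mono (evSet_init_subset s) hGKM
    obtain ⟨χ, hχ, hX⟩ := ih (Fin.init s) hGKM'
    have hM := (isNice_bottSamelson hF _ hGKM').mono (evSet_init_subset s)
    set t := s (Fin.last l)
    have hco : ∀ σ x, ev s σ = x →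
        toCoset t (ev (Fin.init s : Fin l → simpleReflections b) (Fin.init σ : Fin l → Bool)) =
          toCoset t x := by
      rintro σ _ rfl
      rw [ev_succ]
      split_ifs
      · rw [toCoset_mul]
      · rw [mul_one]
    -- An element of the new stalk at `x` is a pair of elements at `x` and `x t`. Its coordinate at
    -- `σ` is the coordinate at `Fin.init σ` of the component at `ev (Fin.init σ)`, which is one of
    -- these two vertices.
    refine ⟨fun x => LinearMap.pi fun σ => LinearMap.proj ⟨Fin.init σ.1, rfl⟩ ∘ₗ
      χ (ev (Fin.init s : Fin l → simpleReflections b) (Fin.init σ.1 : Fin l → Bool)) ∘ₗ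
      LinearMap.proj (R := SymAlg P F)
        (φ := fun y : fibre t (toCoset t x) => (bottSamelson F (Fin.init s)).stalk y)
        ⟨_, hco σ.1 x σ.2⟩ ∘ₗ
      ((bottSamelson F (Fin.init s)).sections (fibre t (toCoset t x))).subtype,
      fun x => ?_, fun f => ?_⟩
    · rw [injective_iff_map_eq_zero]
      intro u hu
      have key : ∀ (σ : {σ // ev s σ = x}) (τ : Fin l → Bool), Fin.init σ.1 = τ →
          ∀ hy : toCoset t (ev (Fin.init s : Fin l → simpleReflections b) τ) = toCoset t x,
          χ (ev (Fin.init s : Fin l → simpleReflections b) τ) (u.1 ⟨_, hy⟩) ⟨τ, rfl⟩ = 0 := by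
        rintro σ _ rfl hy
        exact congrFun hu σ
      suffices h0 : ∀ (y : affineWeylGroup P) (hy : toCoset t y = toCoset t x), u.1 ⟨y, hy⟩ = 0
        from Subtype.ext (funext fun y => h0 y.1 y.2)
      intro y hy
      refine (injective_iff_map_eq_zero _).1 (hχ y) _ (funext ?_)
      rintro ⟨τ, rfl⟩
      -- Each `τ` with product `x` or `x t` extends, by a blank or by `t` respectively, to a `σ`
      -- with product `x`. Thus every old coordinate of `u` occurs among the new ones.
      rcases toCoset_eq t hy with h | h
      · exact key ⟨Fin.snoc (α := fun _ => Bool) τ false, by rw [ev_succ]; simp [h]⟩ τ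
          (Fin.init_snoc _ _) hy
      · exact key ⟨Fin.snoc (α := fun _ => Bool) τ true, by rw [ev_succ]; simp [h, t]⟩ τ
          (Fin.init_snoc _ _) hy
    · rw [mem_xModule_succ]
      constructor
      · rintro ⟨f₁, h₁, f₂, h₂, h⟩
        obtain ⟨m₁, hm₁, hf₁⟩ := (hX f₁).1 h₁
        obtain ⟨m₂, hm₂, hf₂⟩ := (hX f₂).1 h₂
        refine ⟨_, hM.add_twist_mem_globalSections t hF hm₁ hm₂, fun σ => ?_⟩
        rw [← h, ← hf₁, ← hf₂]
        exact map_add_smul_apply (χ (ev (Fin.init s : Fin l → simpleReflections b)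
          (Fin.init σ : Fin l → Bool))) (m₁ _) (m₂ _) _ ⟨Fin.init σ, rfl⟩
      · rintro ⟨m, hm, h⟩
        obtain ⟨m₁, hm₁, m₂, hm₂, hm'⟩ := hM.exists_eq_add_twist t hF
          (fun x hx => mul_last_mem_evSet s hx) (fun e => src_mem_evSet F s e) hGKM hm
        refine ⟨_, (hX _).2 ⟨m₁, hm₁, fun σ => rfl⟩, _, (hX _).2 ⟨m₂, hm₂, fun σ => rfl⟩,
          fun σ => ?_⟩
        rw [← h]
        refine Eq.symm ((congrFun (congrArg (χ _) (hm' (ev s σ) ⟨_, hco σ _ rfl⟩)) _).trans ?_)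
        exact map_add_smul_apply (χ (ev (Fin.init s : Fin l → simpleReflections b)
          (Fin.init σ : Fin l → Bool))) (m₁ _) (m₂ _) _ ⟨Fin.init σ, rfl⟩

/-- The coordinates `χ` at the vertices `ev s σ` assemble to `φ`. Surjectivity of global sections
onto stalks places the image of each `χ x` in `X(s)^x`. -/
theorem nonempty_comparison (hF : (2 : F) ≠ 0) {l : ℕ} (s : Fin l → simpleReflections b)
    (hGKM : (affineGraph b F).GKM F (evSet s)) : Nonempty (Comparison F s) := by
  obtain ⟨χ, hχ, hX⟩ := exists_coordinates hF s hGKM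
  have hM := isNice_bottSamelson hF s hGKM
  let Φ : (bottSamelson F s).globalSections →ₗ[SymAlg P F] SeqModule P F l :=
    LinearMap.pi fun σ => LinearMap.proj ⟨σ, rfl⟩ ∘ₗ χ (ev s σ) ∘ₗ
      LinearMap.proj (R := SymAlg P F) (φ := fun x => (bottSamelson F s).stalk x) (ev s σ) ∘ₗ
      (bottSamelson F s).globalSections.subtype
  have hΦ : ∀ x m, restrictTo F s x (Φ m) = χ x (m.1 x) := by
    intro x m
    funext σ
    obtain ⟨σ, rfl⟩ := σ
    rfl
  have hmem : ∀ x m, χ x m ∈ xStalk F s x := by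
    intro x m
    obtain ⟨g, hg, rfl⟩ := hM.exists_section x m
    exact ⟨Φ ⟨g, hg⟩, (hX _).2 ⟨g, hg, fun _ => rfl⟩, hΦ x ⟨g, hg⟩⟩
  refine ⟨{
    glob := LinearEquiv.ofBijective
      (Φ.codRestrict (xModule F s) fun m => (hX _).2 ⟨m.1, m.2, fun _ => rfl⟩) ⟨?_, ?_⟩
    glob_act := ?_
    stalk := fun x => LinearEquiv.ofBijective ((χ x).codRestrict (xStalk F s x) (hmem x)) ⟨?_, ?_⟩
    comm := fun x m => (hΦ x m).symm }⟩
  · intro m n h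
    refine Subtype.ext (funext fun x => hχ x ?_)
    rw [← hΦ, ← hΦ]
    exact congrArg (restrictTo F s x) (congrArg Subtype.val h)
  · rintro ⟨f, hf⟩
    obtain ⟨m, hm, h⟩ := (hX f).1 hf
    exact ⟨⟨m, hm⟩, Subtype.ext (funext h)⟩
  · intro z m σ
    change χ (ev s σ) (((bottSamelson F s).structureAct (supp_bottSamelson F s) z m).1 (ev s σ))
      ⟨σ, rfl⟩ = z.1 ⟨ev s σ, σ, rfl⟩ * χ (ev s σ) (m.1 (ev s σ)) ⟨σ, rfl⟩
    have h : ((bottSamelson F s).structureAct (supp_bottSamelson F s) z m).1 (ev s σ) =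
        z.1 ⟨ev s σ, σ, rfl⟩ • m.1 (ev s σ) := dif_pos ⟨σ, rfl⟩
    rw [h, map_smul]
    rfl
  · exact fun m n h => hχ x (congrArg Subtype.val h)
  · rintro ⟨_, f, hf, rfl⟩
    obtain ⟨m, hm, h⟩ := (hX f).1 hf
    refine ⟨m x, Subtype.ext ?_⟩
    have hfm : Φ ⟨m, hm⟩ = f := funext h
    exact (hΦ x ⟨m, hm⟩).symm.trans (congrArg _ hfm)

/-! ### Costalks. -/

theorem mem_costalk_of_section {W : Type u} [AddCommGroup W] [Module F W] {G : LabelledGraph W}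
    {M : Sheaf F G} (hG : ∀ e, G.src e ≠ G.tgt e) {g : ∀ x, M.stalk x}
    (hg : g ∈ M.globalSections) {x : G.Vert} (hx : ∀ y, y ≠ x → g y = 0) :
    g x ∈ M.costalk x := by
  intro e he
  cases he with
  | src =>
    refine (hg e).trans ?_
    rw [hx _ (hG e).symm, map_zero]
  | tgt =>
    refine (hg e).symm.trans ?_
    rw [hx _ (hG e), map_zero]

/-- Costalk elements on the sheaf side are values of global sections supported at `x`, and those of
`X(s)_x` come from functions supported on `I(s)_x`. The two supports correspond under `φ`, because
every `φ_y` is injective. -/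
theorem Comparison.stalk_mem_xCostalk_iff {l : ℕ} {s : Fin l → simpleReflections b}
    (φ : Comparison F s) (x : affineWeylGroup P) (m : (bottSamelson F s).stalk x) :
    (φ.stalk x m).1 ∈ xCostalk F s x ↔ m ∈ (bottSamelson F s).costalk x := by
  classical
  constructor
  · rintro ⟨f, hf, hf0, h⟩
    obtain ⟨g, hg⟩ := φ.glob.surjective ⟨f, hf⟩
    have hgf : (φ.glob g).1 = f := congrArg Subtype.val hg
    have hx : g.1 x = m := by
      refine (φ.stalk x).injective (Subtype.ext ?_)
      rw [φ.comm, hgf, h]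
    have hy : ∀ y, y ≠ x → g.1 y = 0 := by
      intro y hy
      refine (map_eq_zero_iff _ (φ.stalk y).injective).1 (Subtype.ext ?_)
      rw [φ.comm, hgf]
      funext σ
      exact hf0 σ.1 fun h' => hy (σ.2.symm.trans h')
    rw [← hx]
    exact mem_costalk_of_section (src_ne_tgt F) g.2 hy
  · intro hm
    -- Extension by zero is a global section exactly because `m` restricts to zero on every edge at
    -- `x`.
    let g : ∀ y, (bottSamelson F s).stalk y := Pi.single x m
    have hgx : g x = m := Pi.single_eq_same _ _
    have hgy : ∀ y, y ≠ x → g y = 0 := fun y hy => Pi.single_eq_of_ne hy _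
    have hg : g ∈ (bottSamelson F s).globalSections := by
      intro e
      by_cases hs : (affineGraph b F).src e = x
      · subst hs
        rw [hgy _ (src_ne_tgt F e).symm, map_zero, hgx]
        exact hm e (LabelledGraph.Inc.src e)
      · rw [hgy _ hs, map_zero]
        by_cases ht : (affineGraph b F).tgt e = x
        · subst ht
          rw [hgx]
          exact (hm e (LabelledGraph.Inc.tgt e)).symm
        · rw [hgy _ ht, map_zero]
    refine ⟨(φ.glob ⟨g, hg⟩).1, (φ.glob ⟨g, hg⟩).2, ?_, ?_⟩
    · intro σ hσ
      have h := φ.comm (ev s σ) ⟨g, hg⟩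
      rw [show (⟨g, hg⟩ : (bottSamelson F s).globalSections).1 (ev s σ) = 0 from hgy _ hσ,
        map_zero] at h
      exact (congrFun h ⟨σ, rfl⟩).symm
    · rw [← φ.comm]
      exact congrArg (fun m => (φ.stalk x m).1) hgx

end UnitSheaf

end BottSamelson

end

theorem corollary2 {ι V N F : Type u} [Finite ι]
    [AddCommGroup V] [Module ℚ V] [AddCommGroup N] [Module ℚ N]
    (P : RootPairing ι ℚ V N) [P.IsRootSystem] [P.IsCrystallographic] [P.IsReduced]
    [P.IsIrreducible] (b : P.Base) [Field F] (hF : (2 : F) ≠ 0)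
    {l : ℕ} (s : Fin l → BottSamelson.simpleReflections b)
    (hGKM : (BottSamelson.affineGraph b F).GKM F (BottSamelson.evSet s)) :
    Nonempty (BottSamelson.Comparison F s) ∧
      ∀ (φ : BottSamelson.Comparison F s) (x : BottSamelson.affineWeylGroup P),
        ∃ ψ : (BottSamelson.bottSamelson F s).costalk x ≃ₗ[BottSamelson.SymAlg P F]
            BottSamelson.xCostalk F s x,
          ∀ u : (BottSamelson.bottSamelson F s).costalk x, (ψ u).1 = (φ.stalk x u.1).1 := by
  refine ⟨BottSamelson.nonempty_comparison hF s hGKM, fun φ x => ?_⟩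
  let f := (BottSamelson.xStalk F s x).subtype ∘ₗ (φ.stalk x).toLinearMap ∘ₗ
    ((BottSamelson.bottSamelson F s).costalk x).subtype
  refine ⟨LinearEquiv.ofBijective (f.codRestrict (BottSamelson.xCostalk F s x) fun u =>
    (φ.stalk_mem_xCostalk_iff x u.1).2 u.2) ⟨fun u v h => ?_, ?_⟩, fun u => rfl⟩
  · have h' : (φ.stalk x u.1).1 = (φ.stalk x v.1).1 :=
      congrArg (fun w : BottSamelson.xCostalk F s x => w.1) h
    exact Subtype.ext ((φ.stalk x).injective (Subtype.ext h'))
  · rintro ⟨g, hg⟩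
    -- Forgetting the vanishing condition puts `g` in `X(s)^x`, where `φ_x` is already surjective;
    -- the criterion for costalks then applies to its preimage.
    have hg' : g ∈ BottSamelson.xStalk F s x := by
      obtain ⟨f, hf, -, rfl⟩ := hg
      exact ⟨f, hf, rfl⟩
    obtain ⟨m, hm⟩ := (φ.stalk x).surjective ⟨g, hg'⟩
    have hmg : (φ.stalk x m).1 = g := congrArg Subtype.val hm
    exact ⟨⟨m, (φ.stalk_mem_xCostalk_iff x m).1 (hmg ▸ hg)⟩, Subtype.ext hmg⟩
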